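/- \textbf{Theorem 2.} \emph{Setting.} Consider $\dot x=f(x)+\sum_{i=1}^m g_i(x)u_i$ on $\mathbb R^n$ with $f(0)=0$. Let $\mathbb X\subset\mathbb R^n$ be compact and convex, and let $\mathbb U\subset\mathbb R^m$ be compact with $0\in\operatorname{int}\mathbb U$. For every constant control $u\in\mathbb U$ and every initial value $\hat x\in\mathbb X$, let there be a unique solution $x(t;\hat x,u)$ on $[0,\infty)$. Let $\Phi(x)=(1,\hat\Phi(x))$ with $\hat\Phi(x)=(x,\phi_{n+1}(x),\dots,\phi_N(x))\in\mathbb R^N$, $\phi_k\in C^2(\mathbb R^n)$ and $\phi_k(0)=0$, and let $\mathbb V$ be the span of the components of $\Phi$. Assume that $\mathbb V$ is invariant: for every $\phi\in\mathbb V$, $u\in\mathbb U$ and $t\ge0$, the function $\hat x\mapsto\phi(x(t;\hat x,u))$ on $\mathbb X$ is the restriction of an element of $\mathbb V$. \emph{Data.} Let $\rho$ be a probability distribution on $\mathbb X$ for which the components of $\Phi$ are linearly independent $\rho$-almost everywhere (for instance the uniform distribution, if they are linearly independent in $L^2(\mathbb X)$). For each $\bar u\in\{0,e_1,\dots,e_m\}$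 let $x^{\bar u}_1,\dots,x^{\bar u}_{d^{\bar u}}$ be i.i.d. samples with law $\rho$, with derivative measurements $\dot x_j^{\bar u}=f(x_j^{\bar u})+\sum_i \bar u_i g_i(x_j^{\bar u})$. Let $X^0$ have the columns $\hat\Phi(x_j^0)$, let $X^{e_i}$ have the columns $\Phi(x_j^{e_i})$, and let $Y^{\bar u}$ have the columns $D\hat\Phi(x_j^{\bar u})\,\dot x_j^{\bar u}$. Let $A$ minimize $\|Y^0-AX^0\|_F$, let $[B_{0,i}\ \hat B_i]$ minimize $\|Y^{e_i}-[B_{0,i}\ \hat B_i]X^{e_i}\|_F$, and put $B_0=[B_{0,1}\cdots B_{0,m}]$, $\tilde B=[\hat B_1-A\ \cdots\ \hat B_m-A]$. \emph{Claim.} Let $c_r>0$ and $\delta\in(0,1)$. There is $d_0\in\mathbb N$ such that, whenever $d^{\bar u}\ge d_0$ for all $\bar u$, the following holds with probability at least $1-\delta$. Let $Q_z=Q_z^\top\prec0$, $S_z\in\mathbb R^N$, $R_z>0$, and $\begin{bmatrix}\tilde Q_z&\tilde S_z\\ \tilde S_z^\top&\tilde R_z\end{bmatrix}=\begin{bmatrix}Q_z&S_z\\S_z^\top&R_z\end{bmatrix}^{-1}$.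 Let $0\prec P=P^\top\in\mathbb R^{N\times N}$, $L\in\mathbb R^{m\times N}$, $L_w\in\mathbb R^{m\times Nm}$, $0\prec\Lambda=\Lambda^\top\in\mathbb R^{m\times m}$, $\nu>0$ and $\tau>0$ satisfy $$\begin{bmatrix} -AP-B_0L-PA^\top-L^\top B_0^\top-\tau I_N&\star&\star&\star\\ -L-(\Lambda\otimes\tilde S_z^\top)\tilde B^\top-(I_m\otimes\tilde S_z^\top)L_w^\top B_0^\top&\Lambda\otimes\tilde R_z-L_w(I_m\otimes\tilde S_z)-(I_m\otimes\tilde S_z^\top)L_w^\top&\star&\star\\ -\begin{bmatrix}P&L^\top\end{bmatrix}^\top&-\begin{bmatrix}0&L_w^\top\end{bmatrix}^\top(I_m\otimes\tilde S_z)&\tfrac12\tau c_r^{-2}I_{N+m}&\star\\ (\Lambda\otimes I_N)\tilde B^\top+L_w^\top B_0^\top&L_w^\top&-\begin{bmatrix}0&L_w^\top\end{bmatrix}&-\Lambda\otimes\tilde Q_z^{-1} \end{bmatrix}\succ0$$ (where $\star$ denotes the blocks given by symmetry) and $$\begin{bmatrix}P&PS_z&P&0\\S_z^\top P&\nu R_z&0&\nu\\P&0&-\nu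 Q_z^{-1}&0\\0&\nu&0&1\end{bmatrix}\succeq0,$$ and let $\mathcal X_{\mathrm{RoA}}=\{x\in\mathbb R^n\mid\hat\Phi(x)^\top P^{-1}\hat\Phi(x)\le1\}\subseteq\mathbb X$. Then $I-L_w(\Lambda^{-1}\otimes\hat\Phi(x))$ is invertible for all $x\in\mathcal X_{\mathrm{RoA}}$, and the controller $$\mu(x)=(I-L_w(\Lambda^{-1}\otimes\hat\Phi(x)))^{-1}LP^{-1}\hat\Phi(x)$$ exponentially stabilizes the nonlinear system on $\mathcal X_{\mathrm{RoA}}$: from every $\hat x\in\mathcal X_{\mathrm{RoA}}$ the closed loop $\dot x=f(x)+\sum_i g_i(x)\mu_i(x)$ has a solution on $[0,\infty)$, and there are $M,\alpha>0$ such that every closed-loop solution starting in $\mathcal X_{\mathrm{RoA}}$ stays in $\mathcal X_{\mathrm{RoA}}$ and satisfies $\|x(t)\|\le Me^{-\alpha t}\|x(0)\|$. -/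

import Mathlib

open MeasureTheory ProbabilityTheory Matrix Set

universe u

noncomputable section

namespace KoopmanControl

/-- The state space `ℝⁿ` with the Euclidean norm. -/
abbrev State (n : ℕ) := EuclideanSpace ℝ (Fin n)

/-- Indices of the reduced lifted state: `n` coordinates followed by `q` further observables, so that
the dimension of the reduced lifted state is `N = n + q`. -/
abbrev LiftIdx (n q : ℕ) := Fin n ⊕ Fin q

section Dynamics

variable {n q m : ℕ}

/-- The vector field `f(x) + ∑ᵢ uᵢ gᵢ(x)`. -/
def controlField (f : State n → State n) (g : Fin m → State n → State n) (u : Fin m → ℝ)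
    (x : State n) : State n :=
  f x + ∑ i, u i • g i x

/-- `x` solves `ẋ = F(x)` on the set of times `I` (with one-sided derivatives at end points of `I`). -/
def IsSolutionOn (F : State n → State n) (I : Set ℝ) (x : ℝ → State n) : Prop :=
  ∀ t ∈ I, HasDerivWithinAt x (F (x t)) I t

/-- For every constant control in `U` and every initial value in `X`, the system has exactly one
solution on `[0, ∞)`. -/
def HasUniqueSolutions (f : State n → State n) (g : Fin m → State n → State n)
    (X : Set (State n)) (U : Set (Fin m → ℝ)) : Prop :=
  ∀ u ∈ U, ∀ x₀ ∈ X, ∃ x : ℝ → State n, x 0 = x₀ ∧ IsSolutionOn (controlField f g u) (Ici 0) x ∧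
    ∀ y : ℝ → State n, y 0 = x₀ → IsSolutionOn (controlField f g u) (Ici 0) y → EqOn y x (Ici 0)

/-- The reduced lifted state `Φ̂(x) = (x, ψ₁(x), …, ψ_q(x))`. -/
def liftHat (ψ : Fin q → State n → ℝ) (x : State n) : LiftIdx n q → ℝ :=
  Sum.elim (fun i => x i) (fun k => ψ k x)

/-- The full lifting `Φ(x) = (1, Φ̂(x))`. -/
def lift (ψ : Fin q → State n → ℝ) (x : State n) : Unit ⊕ LiftIdx n q → ℝ :=
  Sum.elim (fun _ => 1) (liftHat ψ x)

/-- The dictionary: the span of all components of `Φ`. -/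
def dictionary (ψ : Fin q → State n → ℝ) : Submodule ℝ (State n → ℝ) :=
  Submodule.span ℝ (range fun k : Unit ⊕ LiftIdx n q => fun x : State n => lift ψ x k)

/-- Invariance of the dictionary: for every constant control `u ∈ U`, every time `t ≥ 0` and every
`φ` in the dictionary, the map `x̂ ↦ φ(x(t; x̂, u))`, `x̂ ∈ X`, belongs to the dictionary. -/
def DictionaryInvariant (f : State n → State n) (g : Fin m → State n → State n)
    (ψ : Fin q → State n → ℝ) (X : Set (State n)) (U : Set (Fin m → ℝ)) : Prop :=
  ∀ u ∈ U, ∀ t : ℝ, 0 ≤ t → ∀ φ ∈ dictionary ψ, ∃ φ' ∈ dictionary ψ,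
    ∀ x : ℝ → State n, x 0 ∈ X → IsSolutionOn (controlField f g u) (Ici 0) x →
      φ (x t) = φ' (x 0)

/-- Exponential stability of the origin for `ẋ = F(x)` on the set `R` of initial values: from every
point of `R` there is a solution on `[0, ∞)`, and with uniform constants `M`, `α` all solutions that
start in `R` remain in `R` and decay exponentially, on whatever interval `[0, T)` they are defined. -/
def ExponentiallyStableOn (F : State n → State n) (R : Set (State n)) : Prop :=
  (∀ x₀ ∈ R, ∃ x : ℝ → State n, x 0 = x₀ ∧ IsSolutionOn F (Ici 0) x) ∧
  ∃ M > (0 : ℝ), ∃ α > (0 : ℝ), ∀ (x : ℝ → State n) (T : ℝ), x 0 ∈ R →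
    IsSolutionOn F (Ico 0 T) x →
      ∀ t ∈ Ico 0 T, x t ∈ R ∧ ‖x t‖ ≤ M * Real.exp (-α * t) * ‖x 0‖

end Dynamics

section EDMD

variable {n q m : ℕ}

/-- The control values used for data generation: `0` (index `none`) and the unit vectors `eᵢ`
(index `some i`). -/
def dataInput : Option (Fin m) → Fin m → ℝ
  | none => 0
  | some i => Pi.single i 1

/-- The Frobenius norm. -/
def frobenius {a b : Type} [Fintype a] [Fintype b] (M : Matrix a b ℝ) : ℝ :=
  Real.sqrt (∑ i, ∑ j, M i j ^ 2)

/-- The columns `Φ̂(x_j)`. -/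
def dataXHat (ψ : Fin q → State n → ℝ) {d : ℕ} (x : Fin d → State n) :
    Matrix (LiftIdx n q) (Fin d) ℝ :=
  of fun k j => liftHat ψ (x j) k

/-- The columns `Φ(x_j)`. -/
def dataX (ψ : Fin q → State n → ℝ) {d : ℕ} (x : Fin d → State n) :
    Matrix (Unit ⊕ LiftIdx n q) (Fin d) ℝ :=
  of fun k j => lift ψ (x j) k

/-- The columns `(∇φ_k(x_j)ᵀ ẋ_j)_k` with `k` ranging over the reduced lifted state, where
`ẋ_j` are the derivative measurements. -/
def dataY (ψ : Fin q → State n → ℝ) {d : ℕ} (x xdot : Fin d → State n) :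
    Matrix (LiftIdx n q) (Fin d) ℝ :=
  of fun k j => fderiv ℝ (fun y => liftHat ψ y k) (x j) (xdot j)

/-- `A`, `B₀`, `B̂₁, …, B̂_m` are least-squares (generator EDMD) estimates for the sampling points
`x ū j` under the constant controls `ū ∈ {0, e₁, …, e_m}`:
`A ∈ argmin ‖Y⁰ - A X⁰‖` and `[B₀ᵢ B̂ᵢ] ∈ argmin ‖Y^{eᵢ} - [B₀ᵢ B̂ᵢ] X^{eᵢ}‖` in the Frobenius norm. -/
structure IsEDMD (f : State n → State n) (g : Fin m → State n → State n)
    (ψ : Fin q → State n → ℝ) {d : Option (Fin m) → ℕ} (x : ∀ k, Fin (d k) → State n)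
    (A : Matrix (LiftIdx n q) (LiftIdx n q) ℝ) (B₀ : Matrix (LiftIdx n q) (Fin m) ℝ)
    (Bhat : Fin m → Matrix (LiftIdx n q) (LiftIdx n q) ℝ) : Prop where
  drift : ∀ A' : Matrix (LiftIdx n q) (LiftIdx n q) ℝ,
    frobenius (dataY ψ (x none) (fun j => controlField f g (dataInput none) (x none j))
        - A * dataXHat ψ (x none)) ≤
      frobenius (dataY ψ (x none) (fun j => controlField f g (dataInput none) (x none j))
        - A' * dataXHat ψ (x none))
  input : ∀ (i : Fin m) (C : Matrix (LiftIdx n q) (Unit ⊕ LiftIdx n q) ℝ),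
    frobenius (dataY ψ (x (some i))
          (fun j => controlField f g (dataInput (some i)) (x (some i) j))
        - fromCols (replicateCol Unit (fun a => B₀ a i)) (Bhat i) * dataX ψ (x (some i))) ≤
      frobenius (dataY ψ (x (some i))
          (fun j => controlField f g (dataInput (some i)) (x (some i) j))
        - C * dataX ψ (x (some i)))

/-- `B̃ = [B₁ ⋯ B_m]` with `Bᵢ = B̂ᵢ - A`. -/
def bilinearMatrix (A : Matrix (LiftIdx n q) (LiftIdx n q) ℝ)
    (Bhat : Fin m → Matrix (LiftIdx n q) (LiftIdx n q) ℝ) :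
    Matrix (LiftIdx n q) (Fin m × LiftIdx n q) ℝ :=
  of fun a p => (Bhat p.1 - A) a p.2

end EDMD

section LMI

variable {ι : Type} {m : ℕ}

/-- The Kronecker product `M ⊗ v` of an `m × m` matrix with a column vector. -/
def kronCol (M : Matrix (Fin m) (Fin m) ℝ) (v : ι → ℝ) : Matrix (Fin m × ι) (Fin m) ℝ :=
  of fun p j => M p.1 j * v p.2

/-- The Kronecker product `M ⊗ vᵀ` of an `m × m` matrix with a row vector. -/
def kronRow (M : Matrix (Fin m) (Fin m) ℝ) (v : ι → ℝ) : Matrix (Fin m) (Fin m × ι) ℝ :=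
  of fun i p => M i p.1 * v p.2

/-- The symmetric `4 × 4` block matrix with given blocks on and below the diagonal. -/
def symBlock4 {a b c e : Type} (M₁₁ : Matrix a a ℝ)
    (M₂₁ : Matrix b a ℝ) (M₂₂ : Matrix b b ℝ)
    (M₃₁ : Matrix c a ℝ) (M₃₂ : Matrix c b ℝ) (M₃₃ : Matrix c c ℝ)
    (M₄₁ : Matrix e a ℝ) (M₄₂ : Matrix e b ℝ) (M₄₃ : Matrix e c ℝ) (M₄₄ : Matrix e e ℝ) :
    Matrix ((a ⊕ b) ⊕ (c ⊕ e)) ((a ⊕ b) ⊕ (c ⊕ e)) ℝ :=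
  fromBlocks (fromBlocks M₁₁ M₂₁ᵀ M₂₁ M₂₂) (fromBlocks M₃₁ᵀ M₄₁ᵀ M₃₂ᵀ M₄₂ᵀ)
    (fromBlocks M₃₁ M₃₂ M₄₁ M₄₂) (fromBlocks M₃₃ M₄₃ᵀ M₄₃ M₄₄)

variable [Fintype ι] [DecidableEq ι]

/-- The inverse of `[Q S; Sᵀ R]` (invertible whenever `Q ≺ 0` and `R > 0`). -/
def multiplierInv (Q : Matrix ι ι ℝ) (S : ι → ℝ) (R : ℝ) : Matrix (ι ⊕ Unit) (ι ⊕ Unit) ℝ :=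
  (fromBlocks Q (replicateCol Unit S) (replicateRow Unit S) (of fun _ _ => R))⁻¹

/-- The block `Q̃` of the inverse multiplier. -/
def tildeQ (Q : Matrix ι ι ℝ) (S : ι → ℝ) (R : ℝ) : Matrix ι ι ℝ :=
  (multiplierInv Q S R).toBlocks₁₁

/-- The block `S̃` of the inverse multiplier. -/
def tildeS (Q : Matrix ι ι ℝ) (S : ι → ℝ) (R : ℝ) : ι → ℝ :=
  fun i => multiplierInv Q S R (Sum.inl i) (Sum.inr ())

/-- The block `R̃` of the inverse multiplier. -/
def tildeR (Q : Matrix ι ι ℝ) (S : ι → ℝ) (R : ℝ) : ℝ :=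
  multiplierInv Q S R (Sum.inr ()) (Sum.inr ())

/-- The matrix of the first (stability) linear matrix inequality. -/
def stabilityMatrix (A : Matrix ι ι ℝ) (B₀ : Matrix ι (Fin m) ℝ) (Bt : Matrix ι (Fin m × ι) ℝ)
    (Q : Matrix ι ι ℝ) (S : ι → ℝ) (R c τ : ℝ)
    (P : Matrix ι ι ℝ) (L : Matrix (Fin m) ι ℝ) (Lw : Matrix (Fin m) (Fin m × ι) ℝ)
    (Λ : Matrix (Fin m) (Fin m) ℝ) :
    Matrix ((ι ⊕ Fin m) ⊕ ((ι ⊕ Fin m) ⊕ (Fin m × ι)))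
      ((ι ⊕ Fin m) ⊕ ((ι ⊕ Fin m) ⊕ (Fin m × ι))) ℝ :=
  symBlock4
    -- block (1,1)
    (-(A * P) - B₀ * L - P * Aᵀ - Lᵀ * B₀ᵀ - τ • (1 : Matrix ι ι ℝ))
    -- blocks (2,1), (2,2)
    (-L - kronRow Λ (tildeS Q S R) * Btᵀ - kronRow (1 : Matrix (Fin m) (Fin m) ℝ) (tildeS Q S R) * Lwᵀ * B₀ᵀ)
    (tildeR Q S R • Λ - Lw * kronCol (1 : Matrix (Fin m) (Fin m) ℝ) (tildeS Q S R) - kronRow (1 : Matrix (Fin m) (Fin m) ℝ) (tildeS Q S R) * Lwᵀ)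
    -- blocks (3,1), (3,2), (3,3)
    (-(fromCols P Lᵀ)ᵀ)
    (-((fromCols (0 : Matrix (Fin m × ι) ι ℝ) Lwᵀ)ᵀ * kronCol (1 : Matrix (Fin m) (Fin m) ℝ) (tildeS Q S R)))
    ((τ * (1 / 2) * (c ^ 2)⁻¹) • (1 : Matrix (ι ⊕ Fin m) (ι ⊕ Fin m) ℝ))
    -- blocks (4,1), (4,2), (4,3), (4,4)
    (kroneckerMap (· * ·) Λ (1 : Matrix ι ι ℝ) * Btᵀ + Lwᵀ * B₀ᵀ)
    Lwᵀ
    (-(fromCols (0 : Matrix (Fin m × ι) ι ℝ) Lwᵀ))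
    (-(kroneckerMap (· * ·) Λ (tildeQ Q S R)⁻¹))

/-- The matrix of the second (invariance) linear matrix inequality. -/
def invarianceMatrix (Q : Matrix ι ι ℝ) (S : ι → ℝ) (R ν : ℝ) (P : Matrix ι ι ℝ) :
    Matrix ((ι ⊕ Unit) ⊕ (ι ⊕ Unit)) ((ι ⊕ Unit) ⊕ (ι ⊕ Unit)) ℝ :=
  symBlock4
    P
    (replicateRow Unit S * P) (of fun _ _ => ν * R)
    P 0 (-(ν • Q⁻¹))
    0 (of fun _ _ => ν) 0 (of fun _ _ => 1)

end LMI

section Controller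

variable {n q m : ℕ}

/-- The matrix `I - L_w (Λ⁻¹ ⊗ Φ̂(x))`. -/
def gainMatrix (ψ : Fin q → State n → ℝ) (Lw : Matrix (Fin m) (Fin m × LiftIdx n q) ℝ)
    (Λ : Matrix (Fin m) (Fin m) ℝ) (x : State n) : Matrix (Fin m) (Fin m) ℝ :=
  1 - Lw * kronCol Λ⁻¹ (liftHat ψ x)

/-- The controller `μ(x) = (I - L_w (Λ⁻¹ ⊗ Φ̂(x)))⁻¹ L P⁻¹ Φ̂(x)`. -/
def controller (ψ : Fin q → State n → ℝ) (P : Matrix (LiftIdx n q) (LiftIdx n q) ℝ)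
    (L : Matrix (Fin m) (LiftIdx n q) ℝ) (Lw : Matrix (Fin m) (Fin m × LiftIdx n q) ℝ)
    (Λ : Matrix (Fin m) (Fin m) ℝ) (x : State n) : Fin m → ℝ :=
  ((gainMatrix ψ Lw Λ x)⁻¹ * L * P⁻¹) *ᵥ liftHat ψ x

/-- The sublevel set `{x | Φ̂(x)ᵀ P⁻¹ Φ̂(x) ≤ 1}`. -/
def regionOfAttraction (ψ : Fin q → State n → ℝ) (P : Matrix (LiftIdx n q) (LiftIdx n q) ℝ) :
    Set (State n) :=
  {x | liftHat ψ x ⬝ᵥ (P⁻¹ *ᵥ liftHat ψ x) ≤ 1}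

end Controller

end KoopmanControl

end

/-!
With enough samples the least-squares model is exact with high probability, so the residual allowed
for by the constant `c` is zero and the linear matrix inequalities certify the true system.

*Exactness.* By invariance of the dictionary, difference quotients of observables along the flow of
a constant control lie in a finite-dimensional, hence closed, space of functions on `X`; so does
their limit, the derivative of the observable along the vector field (`exists_coeff_liftDeriv`). As
`U` is a neighbourhood of zero, this extends by linearity to the drift and to each input field
(`exists_lifted_model`): on `X` the lifted dynamics are exactly bilinear. The least-squares problems
then have zero residual, and if the lifted samples span, their solution is unique
(`lifted_dynamics_of_isEDMD`). The drift is regressed without the constant observable; this is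
harmless because the region of attraction contains the origin, which is an equilibrium.

*Probability.* Linear independence of the observables almost everywhere gives points in the support
of `ρ` with linearly independent lifted values, and this persists on neighbourhoods, which have
positive measure. The samples span as soon as each neighbourhood is hit, and the probability of
missing one of them decays geometrically (`exists_event_spanning_samples`).

*Stability.* The second matrix inequality puts the region of attraction into the set of `x` for
which the multiplier form is nonnegative at `(Φ̂(x), 1)`. On the orthogonal complement of that
vector the inverse multiplier is nonpositive (`multiplierInv_nonpos`). Testing the first matrix
inequality at `(y, s, 0, v)`, with `s` determined by the closed loop and `v` optimal, leaves
multiplier terms of this sign (`stability_form`). Taking `y = 0` shows that the gain matrix is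
invertible; taking `y = P⁻¹ Φ̂(x)` gives `V̇ ≤ -τ |P⁻¹ Φ̂(x)|²` for `V(x) = Φ̂(x)ᵀ P⁻¹ Φ̂(x)`
(`closed_loop_dissipation`). Grönwall's inequality gives invariance and exponential decay
(`lyapunov_decay`), valid for vector fields that are arbitrary off the region of attraction.
Solutions exist because on the region of attraction, a compact set, the closed loop coincides with a
field that is smooth nearby, which is cut off to a bounded Lipschitz field.
-/

namespace KoopmanControl

open Filter Topology

/-! ### The multiplier and its inverse -/

section Multiplier

variable {ι : Type} [Fintype ι]

lemma dotProduct_transpose_mulVec {a b : Type} [Fintype a] [Fintype b] (M : Matrix b a ℝ)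
    (x : a → ℝ) (w : b → ℝ) : x ⬝ᵥ (Mᵀ *ᵥ w) = w ⬝ᵥ (M *ᵥ x) := by
  rw [mulVec_transpose, dotProduct_comm, dotProduct_mulVec]

lemma dotProduct_mulVec_comm_of_isSymm {κ : Type} [Fintype κ] {M : Matrix κ κ ℝ} (hM : Mᵀ = M)
    (v w : κ → ℝ) : v ⬝ᵥ (M *ᵥ w) = w ⬝ᵥ (M *ᵥ v) := by
  rw [← dotProduct_transpose_mulVec, hM]

lemma transpose_eq_of_posDef {κ : Type} [Fintype κ] {M : Matrix κ κ ℝ} (hM : M.PosDef) :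
    Mᵀ = M := by
  simpa [IsHermitian] using hM.isHermitian

/-- The multiplier `[Q S; Sᵀ R]`. -/
def multiplier (Q : Matrix ι ι ℝ) (S : ι → ℝ) (R : ℝ) : Matrix (ι ⊕ Unit) (ι ⊕ Unit) ℝ :=
  fromBlocks Q (replicateCol Unit S) (replicateRow Unit S) (of fun _ _ => R)

lemma multiplier_mulVec (Q : Matrix ι ι ℝ) (S v : ι → ℝ) (R : ℝ) (t : Unit → ℝ) :
    multiplier Q S R *ᵥ Sum.elim v t =
      Sum.elim (Q *ᵥ v + t () • S) (fun _ => S ⬝ᵥ v + R * t ()) := by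
  rw [multiplier, fromBlocks_mulVec]
  ext (i | i) <;> simp [mulVec, dotProduct, mul_comm]

lemma multiplier_form (Q : Matrix ι ι ℝ) (S v : ι → ℝ) (R : ℝ) (t : Unit → ℝ) :
    Sum.elim v t ⬝ᵥ (multiplier Q S R *ᵥ Sum.elim v t) =
      v ⬝ᵥ (Q *ᵥ v) + 2 * t () * (S ⬝ᵥ v) + R * t () ^ 2 := by
  rw [multiplier_mulVec, sumElim_dotProduct_sumElim]
  simp only [dotProduct_add, dotProduct_smul, smul_eq_mul, dotProduct_comm v S]
  simp [dotProduct]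
  ring

variable [DecidableEq ι]

lemma multiplier_isUnit_det {Q : Matrix ι ι ℝ} {S : ι → ℝ} {R : ℝ} (hQ : (-Q).PosDef) (hR : 0 < R) :
    IsUnit (multiplier Q S R).det := by
  rw [← Matrix.isUnit_iff_isUnit_det, ← mulVec_injective_iff_isUnit]
  refine (injective_iff_map_eq_zero (multiplier Q S R).mulVecLin).2 fun w hw => ?_
  obtain ⟨v, t, rfl⟩ : ∃ v t, w = Sum.elim v t := ⟨_, _, (Sum.elim_comp_inl_inr w).symm⟩
  simp only [mulVecLin_apply, multiplier_mulVec] at hw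
  have h1 : Q *ᵥ v + t () • S = 0 := funext fun i => congrFun hw (Sum.inl i)
  have h2 : S ⬝ᵥ v + R * t () = 0 := congrFun hw (Sum.inr ())
  have h3 : v ⬝ᵥ (Q *ᵥ v) + t () * (S ⬝ᵥ v) = 0 := by
    have := congrArg (v ⬝ᵥ ·) h1
    simpa [dotProduct_add, dotProduct_comm v S] using this
  have hv : v = 0 := by
    by_contra hv
    have := hQ.dotProduct_mulVec_pos hv
    simp only [star_trivial, neg_mulVec, dotProduct_neg] at this
    rw [eq_neg_of_add_eq_zero_left h2] at h3
    nlinarith [mul_nonneg hR.le (sq_nonneg (t ()))]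
  subst hv
  have ht : t () = 0 := by simpa [hR.ne'] using h2
  ext (i | i)
  · rfl
  · exact ht

lemma multiplierInv_eq (Q : Matrix ι ι ℝ) (S : ι → ℝ) (R : ℝ) :
    multiplierInv Q S R = (multiplier Q S R)⁻¹ := rfl

lemma multiplierInv_transpose {Q : Matrix ι ι ℝ} {S : ι → ℝ} {R : ℝ} (hQ : Qᵀ = Q) :
    (multiplierInv Q S R)ᵀ = multiplierInv Q S R := by
  rw [multiplierInv_eq, transpose_nonsing_inv, multiplier, fromBlocks_transpose, hQ]
  rfl

lemma multiplierInv_eq_multiplier {Q : Matrix ι ι ℝ} {S : ι → ℝ} {R : ℝ} (hQ : Qᵀ = Q) :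
    multiplierInv Q S R = multiplier (tildeQ Q S R) (tildeS Q S R) (tildeR Q S R) := by
  ext (i | i) (j | j)
  · rfl
  · rfl
  · exact congrFun (congrFun (multiplierInv_transpose (S := S) (R := R) hQ) (Sum.inl j)) (Sum.inr i)
  · rfl

/-- The block `Q̃` is invertible: its inverse is the Schur complement `Q - R⁻¹ S Sᵀ`. -/
lemma tildeQ_isUnit_det {Q : Matrix ι ι ℝ} {S : ι → ℝ} {R : ℝ} (hQ : (-Q).PosDef) (hR : 0 < R) :
    IsUnit (tildeQ Q S R).det := by
  have hQs : Qᵀ = Q := by simpa using congrArg Neg.neg (transpose_eq_of_posDef hQ)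
  have h : multiplier Q S R * multiplierInv Q S R = 1 :=
    mul_nonsing_inv _ (multiplier_isUnit_det hQ hR)
  rw [multiplierInv_eq_multiplier hQs, multiplier, multiplier, fromBlocks_multiply,
    ← fromBlocks_one, fromBlocks_inj] at h
  obtain ⟨h1, -, h2, -⟩ := h
  have h3 : replicateRow Unit (tildeS Q S R) = -(R⁻¹ • (replicateRow Unit S * tildeQ Q S R)) := by
    ext i j
    have := congrFun (congrFun h2 i) j
    simp [mul_apply] at this ⊢
    field_simp
    linarith
  refine (Matrix.isUnit_iff_isUnit_det _).1 (isUnit_iff_exists_inv'.2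
    ⟨Q - R⁻¹ • (replicateCol Unit S * replicateRow Unit S), ?_⟩)
  rw [Matrix.sub_mul, ← h1, h3, Matrix.mul_neg, smul_mul, Matrix.mul_smul, Matrix.mul_assoc,
    sub_eq_add_neg]

/-- Dualization: if the quadratic form of the multiplier, which has only one positive eigenvalue, is
nonnegative at `(z, 1)`, then the form of the inverse multiplier is nonpositive on the orthogonal
complement of `(z, 1)`. -/
lemma multiplierInv_nonpos {Q : Matrix ι ι ℝ} {S z : ι → ℝ} {R : ℝ} (hQ : (-Q).PosDef) (hR : 0 < R)
    (hz : 0 ≤ z ⬝ᵥ (Q *ᵥ z) + 2 * (S ⬝ᵥ z) + R) (w : ι → ℝ) :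
    w ⬝ᵥ (tildeQ Q S R *ᵥ w) - 2 * (z ⬝ᵥ w) * (tildeS Q S R ⬝ᵥ w) +
      tildeR Q S R * (z ⬝ᵥ w) ^ 2 ≤ 0 := by
  have hQs : Qᵀ = Q := by simpa using congrArg Neg.neg (transpose_eq_of_posDef hQ)
  set W : ι ⊕ Unit → ℝ := Sum.elim w (fun _ => -(z ⬝ᵥ w)) with hW
  have e1 : W ⬝ᵥ (multiplierInv Q S R *ᵥ W) = w ⬝ᵥ (tildeQ Q S R *ᵥ w)
      - 2 * (z ⬝ᵥ w) * (tildeS Q S R ⬝ᵥ w) + tildeR Q S R * (z ⬝ᵥ w) ^ 2 := by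
    rw [multiplierInv_eq_multiplier hQs, multiplier_form]; ring
  rw [← e1]
  obtain ⟨v, t, hvt⟩ : ∃ v t, multiplierInv Q S R *ᵥ W = Sum.elim v t :=
    ⟨_, _, (Sum.elim_comp_inl_inr _).symm⟩
  have hback : W = multiplier Q S R *ᵥ Sum.elim v t := by
    rw [← hvt, mulVec_mulVec, multiplierInv_eq, mul_nonsing_inv _ (multiplier_isUnit_det hQ hR),
      one_mulVec]
  rw [multiplier_mulVec] at hback
  have b1 : w = Q *ᵥ v + t () • S := funext fun i => congrFun hback (Sum.inl i)
  have b2 : -(z ⬝ᵥ w) = S ⬝ᵥ v + R * t () := congrFun hback (Sum.inr ())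
  have e2 : W ⬝ᵥ (multiplierInv Q S R *ᵥ W) =
      v ⬝ᵥ (Q *ᵥ v) + 2 * t () * (S ⬝ᵥ v) + R * t () ^ 2 := by
    rw [hvt, hback, dotProduct_comm, ← multiplier_mulVec, multiplier_form]
  rw [e2]
  -- the vector `(v, t) - t (z, 1)` has last entry zero, where the form is that of `Q ≺ 0`
  have hneg : (v - t () • z) ⬝ᵥ (Q *ᵥ (v - t () • z)) ≤ 0 := by
    have := hQ.posSemidef.dotProduct_mulVec_nonneg (v - t () • z)
    simpa only [star_trivial, neg_mulVec, dotProduct_neg, Left.nonneg_neg_iff] using this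
  have hexp : (v - t () • z) ⬝ᵥ (Q *ᵥ (v - t () • z)) =
      v ⬝ᵥ (Q *ᵥ v) - 2 * t () * (z ⬝ᵥ (Q *ᵥ v)) + t () ^ 2 * (z ⬝ᵥ (Q *ᵥ z)) := by
    simp only [mulVec_sub, mulVec_smul, sub_dotProduct, dotProduct_sub, smul_dotProduct,
      dotProduct_smul, smul_eq_mul, dotProduct_mulVec_comm_of_isSymm hQs v z]
    ring
  have b3 : z ⬝ᵥ (Q *ᵥ v) + t () * (S ⬝ᵥ z) + S ⬝ᵥ v + R * t () = 0 := by
    rw [b1, dotProduct_add, dotProduct_smul, smul_eq_mul, dotProduct_comm z S] at b2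
    linarith
  rw [hexp] at hneg
  have b4 : z ⬝ᵥ (Q *ᵥ v) = -(t () * (S ⬝ᵥ z) + S ⬝ᵥ v + R * t ()) := by linarith
  rw [b4] at hneg
  nlinarith [mul_nonneg (sq_nonneg (t ())) hz]

/-- The second linear matrix inequality: on `{z | zᵀ P⁻¹ z ≤ 1}` the quadratic form of the
multiplier is nonnegative at `(z, 1)`. -/
lemma multiplier_form_nonneg_of_invarianceMatrix {Q : Matrix ι ι ℝ} {S z : ι → ℝ} {R ν : ℝ}
    {P : Matrix ι ι ℝ} (hQ : (-Q).PosDef) (hP : P.PosDef) (hν : 0 < ν)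
    (h : (invarianceMatrix Q S R ν P).PosSemidef) (hz : z ⬝ᵥ (P⁻¹ *ᵥ z) ≤ 1) :
    0 ≤ z ⬝ᵥ (Q *ᵥ z) + 2 * (S ⬝ᵥ z) + R := by
  have hPs := transpose_eq_of_posDef hP
  have hPu : IsUnit P.det := (Matrix.isUnit_iff_isUnit_det _).1 hP.isUnit
  have hQu : IsUnit Q.det := by
    rw [← Matrix.isUnit_iff_isUnit_det]; simpa using hQ.isUnit
  set y := P⁻¹ *ᵥ z with hy
  have hPy : P *ᵥ y = z := by rw [hy, mulVec_mulVec, mul_nonsing_inv _ hPu, one_mulVec]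
  -- the third block is minimized at `ν⁻¹ Q z`, the fourth at `-1`
  have hT := h.dotProduct_mulVec_nonneg
    (Sum.elim (Sum.elim y fun _ => ν⁻¹) (Sum.elim (ν⁻¹ • (Q *ᵥ z)) fun _ => -1))
  have hQQ : Q⁻¹ *ᵥ (Q *ᵥ z) = z := by rw [mulVec_mulVec, nonsing_inv_mul _ hQu, one_mulVec]
  have hyz : y ⬝ᵥ z = z ⬝ᵥ y := dotProduct_comm _ _
  have hQz : (Q *ᵥ z) ⬝ᵥ z = z ⬝ᵥ (Q *ᵥ z) := dotProduct_comm _ _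
  have hrow : (replicateRow Unit S * P)ᵀ *ᵥ (fun _ : Unit => ν⁻¹) = ν⁻¹ • (P *ᵥ S) := by
    rw [transpose_mul, hPs, ← mulVec_mulVec, ← mulVec_smul]
    congr 1
    ext i; simp [mulVec, dotProduct, mul_comm]
  have hrow2 : (replicateRow Unit S * P) *ᵥ y = fun _ => S ⬝ᵥ z := by
    rw [← mulVec_mulVec, hPy]; ext i; simp [mulVec, dotProduct]
  have hyPS : y ⬝ᵥ (P *ᵥ S) = S ⬝ᵥ z := by
    rw [dotProduct_mulVec_comm_of_isSymm hPs, hPy]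
  have hyPQ : y ⬝ᵥ (P *ᵥ (Q *ᵥ z)) = z ⬝ᵥ (Q *ᵥ z) := by
    rw [dotProduct_mulVec_comm_of_isSymm hPs, hPy, dotProduct_comm]
  rw [star_trivial, invarianceMatrix, symBlock4] at hT
  simp only [fromBlocks_mulVec, Sum.elim_comp_inl, Sum.elim_comp_inr,
    sumElim_dotProduct_sumElim, hPs, transpose_zero, hrow, hrow2, mulVec_smul, hPy, zero_mulVec,
    neg_mulVec, smul_mulVec, hQQ, dotProduct_add, dotProduct_smul, dotProduct_neg, smul_dotProduct,
    smul_eq_mul, hyPS, hyPQ, dotProduct_zero, hyz, hQz] at hT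
  simp [dotProduct, mulVec, hν.ne'] at hT
  have hexp : z ⬝ᵥ (Q *ᵥ z) + 2 * (S ⬝ᵥ z) + R =
      ν * (ν⁻¹ * z ⬝ᵥ (Q *ᵥ z) + 2 * (ν⁻¹ * (S ⬝ᵥ z)) + ν⁻¹ * (ν * R * ν⁻¹)) := by
    field_simp
  rw [hexp]
  refine mul_nonneg hν.le ?_
  simp only [dotProduct, mulVec] at hz ⊢
  linarith

end Multiplier

/-! ### Dissipation from the stability inequality -/

section Dissipation

variable {ι : Type} {m : ℕ}

lemma kronCol_transpose (M : Matrix (Fin m) (Fin m) ℝ) (v : ι → ℝ) :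
    (kronCol M v)ᵀ = kronRow Mᵀ v := rfl

lemma kronCol_mul_kronRow (M M' : Matrix (Fin m) (Fin m) ℝ) (v w : ι → ℝ) :
    kronCol M v * kronRow M' w = kroneckerMap (· * ·) (M * M') (vecMulVec v w) := by
  ext ⟨i, a⟩ ⟨j, b⟩
  simp [mul_apply, kronCol, kronRow, vecMulVec, Finset.sum_mul]
  refine Finset.sum_congr rfl fun k _ => by ring

lemma symBlock4_form {a b c e : Type} [Fintype a] [Fintype b] [Fintype c] [Fintype e]
    (M₁₁ : Matrix a a ℝ) (M₂₁ : Matrix b a ℝ) (M₂₂ : Matrix b b ℝ) (M₃₁ : Matrix c a ℝ)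
    (M₃₂ : Matrix c b ℝ) (M₃₃ : Matrix c c ℝ) (M₄₁ : Matrix e a ℝ) (M₄₂ : Matrix e b ℝ)
    (M₄₃ : Matrix e c ℝ) (M₄₄ : Matrix e e ℝ) (y : a → ℝ) (s : b → ℝ) (v : e → ℝ) :
    Sum.elim (Sum.elim y s) (Sum.elim 0 v) ⬝ᵥ
        (symBlock4 M₁₁ M₂₁ M₂₂ M₃₁ M₃₂ M₃₃ M₄₁ M₄₂ M₄₃ M₄₄ *ᵥ
          Sum.elim (Sum.elim y s) (Sum.elim 0 v)) =
      y ⬝ᵥ (M₁₁ *ᵥ y) + 2 * (s ⬝ᵥ (M₂₁ *ᵥ y)) + s ⬝ᵥ (M₂₂ *ᵥ s) +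
        2 * (v ⬝ᵥ (M₄₁ *ᵥ y + M₄₂ *ᵥ s)) + v ⬝ᵥ (M₄₄ *ᵥ v) := by
  simp only [symBlock4, fromBlocks_mulVec, Sum.elim_comp_inl, Sum.elim_comp_inr,
    sumElim_dotProduct_sumElim, mulVec_zero, zero_dotProduct, dotProduct_add,
    dotProduct_transpose_mulVec, add_zero, zero_add]
  ring

variable [Fintype ι]

lemma gain_transpose {z : ι → ℝ} {Lw : Matrix (Fin m) (Fin m × ι) ℝ}
    {Λ : Matrix (Fin m) (Fin m) ℝ} (hΛ : Λ.PosDef) :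
    (1 - Lw * kronCol Λ⁻¹ z)ᵀ = 1 - kronRow Λ⁻¹ z * Lwᵀ := by
  have hΛs : (Λ⁻¹)ᵀ = Λ⁻¹ := transpose_eq_of_posDef hΛ.inv
  rw [transpose_sub, transpose_one, transpose_mul, kronCol_transpose, hΛs]

variable [DecidableEq ι]

lemma kronRow_mul_kronecker (M M' : Matrix (Fin m) (Fin m) ℝ) (v : ι → ℝ) :
    kronRow M v * kroneckerMap (· * ·) M' (1 : Matrix ι ι ℝ) = kronRow (M * M') v := by
  ext i ⟨j, a⟩
  simp [mul_apply, kronRow, Fintype.sum_prod_type, one_apply, Finset.sum_mul]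
  refine Finset.sum_congr rfl fun k _ => by ring

/-- The S-procedure step: at `s = (Λ⁻¹ ⊗ zᵀ) η` the multiplier terms are nonpositive, as a
Kronecker product of positive semidefinite matrices is positive semidefinite. -/
lemma multiplier_terms_nonpos {Q : Matrix ι ι ℝ} {S z : ι → ℝ} {R : ℝ}
    {Λ : Matrix (Fin m) (Fin m) ℝ}
    (hQ : (-Q).PosDef) (hR : 0 < R) (hΛ : Λ.PosDef)
    (hz : 0 ≤ z ⬝ᵥ (Q *ᵥ z) + 2 * (S ⬝ᵥ z) + R) (η : Fin m × ι → ℝ) (s : Fin m → ℝ)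
    (hs : s = kronRow Λ⁻¹ z *ᵥ η) :
    tildeR Q S R * (s ⬝ᵥ (Λ *ᵥ s)) -
        2 * (s ⬝ᵥ (kronRow (1 : Matrix (Fin m) (Fin m) ℝ) (tildeS Q S R) *ᵥ η)) +
      η ⬝ᵥ (kroneckerMap (· * ·) Λ⁻¹ (tildeQ Q S R) *ᵥ η) ≤ 0 := by
  have hQs : Qᵀ = Q := by simpa using congrArg Neg.neg (transpose_eq_of_posDef hQ)
  have hΛu : IsUnit Λ.det := (Matrix.isUnit_iff_isUnit_det _).1 hΛ.isUnit
  have hΛs : (Λ⁻¹)ᵀ = Λ⁻¹ := transpose_eq_of_posDef hΛ.inv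
  set q := tildeQ Q S R
  set σ := tildeS Q S R
  set r := tildeR Q S R
  have hqs : qᵀ = q := by
    ext i j
    exact congrFun
      (congrFun (multiplierInv_transpose (S := S) (R := R) hQs) (Sum.inl i)) (Sum.inl j)
  set N : Matrix ι ι ℝ := -(q - (vecMulVec z σ + vecMulVec σ z) + r • vecMulVec z z) with hN
  have hNp : N.PosSemidef := by
    refine PosSemidef.of_dotProduct_mulVec_nonneg ?_ fun w => ?_
    · have : Nᵀ = N := by
        simp only [hN, transpose_neg, transpose_add, transpose_sub, transpose_smul, hqs,
          transpose_vecMulVec]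
        abel
      simpa [IsHermitian] using this
    · have := multiplierInv_nonpos hQ hR hz w
      simp only [hN, star_trivial, neg_mulVec, add_mulVec, sub_mulVec, smul_mulVec,
        vecMulVec_mulVec, dotProduct_neg, dotProduct_add, dotProduct_sub, dotProduct_smul,
        smul_eq_mul, op_smul_eq_smul]
      rw [dotProduct_comm w z, dotProduct_comm w σ]
      linarith
  have hK := (hΛ.inv.posSemidef.kronecker hNp).dotProduct_mulVec_nonneg η
  rw [star_trivial] at hK
  have t1 : s ⬝ᵥ (Λ *ᵥ s) = η ⬝ᵥ (kroneckerMap (· * ·) Λ⁻¹ (vecMulVec z z) *ᵥ η) := by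
    have : kroneckerMap (· * ·) Λ⁻¹ (vecMulVec z z) =
        kronCol Λ⁻¹ z * kronRow (1 : Matrix (Fin m) (Fin m) ℝ) z := by
      rw [kronCol_mul_kronRow, Matrix.mul_one]
    rw [this, ← mulVec_mulVec, dotProduct_mulVec η, ← mulVec_transpose]
    rw [kronCol_transpose, hΛs, ← hs]
    congr 1
    have h3 : kronRow Λ⁻¹ z = Λ⁻¹ * kronRow (1 : Matrix (Fin m) (Fin m) ℝ) z := by
      ext i ⟨j, a⟩
      simp [mul_apply, kronRow, one_apply]
    rw [hs, h3, mulVec_mulVec, ← Matrix.mul_assoc, mul_nonsing_inv _ hΛu, Matrix.one_mul]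
  have t2 : s ⬝ᵥ (kronRow (1 : Matrix (Fin m) (Fin m) ℝ) σ *ᵥ η) =
      η ⬝ᵥ (kroneckerMap (· * ·) Λ⁻¹ (vecMulVec z σ) *ᵥ η) := by
    have : kroneckerMap (· * ·) Λ⁻¹ (vecMulVec z σ) =
        kronCol Λ⁻¹ z * kronRow (1 : Matrix (Fin m) (Fin m) ℝ) σ := by
      rw [kronCol_mul_kronRow, Matrix.mul_one]
    rw [this, ← mulVec_mulVec, dotProduct_mulVec η, ← mulVec_transpose]
    rw [kronCol_transpose, hΛs, ← hs]
  have t3 : η ⬝ᵥ (kroneckerMap (· * ·) Λ⁻¹ (vecMulVec σ z) *ᵥ η) =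
      η ⬝ᵥ (kroneckerMap (· * ·) Λ⁻¹ (vecMulVec z σ) *ᵥ η) := by
    have : kroneckerMap (· * ·) Λ⁻¹ (vecMulVec σ z) =
        (kroneckerMap (· * ·) Λ⁻¹ (vecMulVec z σ))ᵀ := by
      rw [← kroneckerMap_transpose, transpose_vecMulVec, hΛs]
    rw [this, mulVec_transpose, dotProduct_comm, dotProduct_mulVec]
  have key : kroneckerMap (· * ·) Λ⁻¹ N = -(kroneckerMap (· * ·) Λ⁻¹ q
      - (kroneckerMap (· * ·) Λ⁻¹ (vecMulVec z σ) + kroneckerMap (· * ·) Λ⁻¹ (vecMulVec σ z))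
      + r • kroneckerMap (· * ·) Λ⁻¹ (vecMulVec z z)) := by
    ext ⟨i, a⟩ ⟨j, b⟩
    simp [hN]
    ring
  rw [key] at hK
  simp only [neg_mulVec, add_mulVec, sub_mulVec, smul_mulVec, dotProduct_neg, dotProduct_add,
    dotProduct_sub, dotProduct_smul, smul_eq_mul, t3] at hK
  rw [t1, t2]
  linarith

/-- The costate form of the dissipation inequality: the stability LMI is tested at `(y, s, 0, v)`,
where `v` minimizes over the fourth block. -/
lemma stability_form {Q : Matrix ι ι ℝ} {S z : ι → ℝ} {R c τ : ℝ}
    {A P : Matrix ι ι ℝ} {B₀ : Matrix ι (Fin m) ℝ} {Bt : Matrix ι (Fin m × ι) ℝ}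
    {L : Matrix (Fin m) ι ℝ} {Lw : Matrix (Fin m) (Fin m × ι) ℝ} {Λ : Matrix (Fin m) (Fin m) ℝ}
    (hQ : (-Q).PosDef) (hR : 0 < R) (hP : Pᵀ = P) (hΛ : Λ.PosDef)
    (h : (stabilityMatrix A B₀ Bt Q S R c τ P L Lw Λ).PosDef)
    (hz : 0 ≤ z ⬝ᵥ (Q *ᵥ z) + 2 * (S ⬝ᵥ z) + R) (y : ι → ℝ) (s : Fin m → ℝ)
    (hs : s = kronRow 1 z *ᵥ (Btᵀ *ᵥ y) + kronRow Λ⁻¹ z *ᵥ (Lwᵀ *ᵥ (B₀ᵀ *ᵥ y + s))) :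
    2 * (y ⬝ᵥ (A *ᵥ (P *ᵥ y)) + (B₀ᵀ *ᵥ y + s) ⬝ᵥ (L *ᵥ y)) ≤ -τ * (y ⬝ᵥ y) ∧
      (y = 0 → s = 0) := by
  have hΛu : IsUnit Λ.det := (Matrix.isUnit_iff_isUnit_det _).1 hΛ.isUnit
  have hqu := tildeQ_isUnit_det (S := S) hQ hR
  set q := tildeQ Q S R
  set σ := tildeS Q S R
  set r := tildeR Q S R
  set η : Fin m × ι → ℝ := kroneckerMap (· * ·) Λ (1 : Matrix ι ι ℝ) *ᵥ (Btᵀ *ᵥ y) +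
    Lwᵀ *ᵥ (B₀ᵀ *ᵥ y + s) with hη
  have hsη : s = kronRow Λ⁻¹ z *ᵥ η := by
    rw [hη, mulVec_add, mulVec_mulVec _ _ (kroneckerMap _ _ _), kronRow_mul_kronecker,
      nonsing_inv_mul _ hΛu]
    exact hs
  set v : Fin m × ι → ℝ := kroneckerMap (· * ·) Λ⁻¹ q *ᵥ η with hv
  have hv' : kroneckerMap (· * ·) Λ q⁻¹ *ᵥ v = η := by
    have : kroneckerMap (· * ·) Λ q⁻¹ * kroneckerMap (· * ·) Λ⁻¹ q = 1 := by
      have := Matrix.mul_kronecker_mul Λ Λ⁻¹ q⁻¹ q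
      rw [mul_nonsing_inv _ hΛu, nonsing_inv_mul _ hqu, one_kronecker_one] at this
      exact this.symm
    rw [hv, mulVec_mulVec, this, one_mulVec]
  have hterms := multiplier_terms_nonpos hQ hR hΛ hz η s hsη
  have hkr : kronRow Λ σ =
      kronRow (1 : Matrix (Fin m) (Fin m) ℝ) σ * kroneckerMap (· * ·) Λ (1 : Matrix ι ι ℝ) := by
    rw [kronRow_mul_kronecker, Matrix.one_mul]
  have hform : Sum.elim (Sum.elim y s) (Sum.elim 0 v) ⬝ᵥ
        (stabilityMatrix A B₀ Bt Q S R c τ P L Lw Λ *ᵥ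
          Sum.elim (Sum.elim y s) (Sum.elim 0 v)) =
      -(2 * (y ⬝ᵥ (A *ᵥ (P *ᵥ y)) + (B₀ᵀ *ᵥ y + s) ⬝ᵥ (L *ᵥ y))) - τ * (y ⬝ᵥ y) +
      (r * (s ⬝ᵥ (Λ *ᵥ s)) - 2 * (s ⬝ᵥ (kronRow (1 : Matrix (Fin m) (Fin m) ℝ) σ *ᵥ η)) +
        η ⬝ᵥ (kroneckerMap (· * ·) Λ⁻¹ q *ᵥ η)) := by
    rw [stabilityMatrix, symBlock4_form, show tildeQ Q S R = q from rfl,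
      show tildeS Q S R = σ from rfl, show tildeR Q S R = r from rfl]
    have a1 : (kroneckerMap (· * ·) Λ (1 : Matrix ι ι ℝ) * Btᵀ + Lwᵀ * B₀ᵀ) *ᵥ y +
        Lwᵀ *ᵥ s = η := by
      rw [hη]; simp only [add_mulVec, ← mulVec_mulVec, mulVec_add]; abel
    have a2 : v ⬝ᵥ (-(kroneckerMap (· * ·) Λ q⁻¹) *ᵥ v) = -(v ⬝ᵥ η) := by
      rw [neg_mulVec, hv', dotProduct_neg]
    have a3 : y ⬝ᵥ ((P * Aᵀ) *ᵥ y) = y ⬝ᵥ (A *ᵥ (P *ᵥ y)) := by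
      have : P * Aᵀ = (A * P)ᵀ := by rw [transpose_mul, hP]
      rw [this, dotProduct_transpose_mulVec, mulVec_mulVec]
    have a4 : y ⬝ᵥ ((Lᵀ * B₀ᵀ) *ᵥ y) = y ⬝ᵥ (B₀ *ᵥ (L *ᵥ y)) := by
      rw [← transpose_mul, dotProduct_transpose_mulVec, mulVec_mulVec]
    have a5 : (B₀ᵀ *ᵥ y) ⬝ᵥ (L *ᵥ y) = y ⬝ᵥ (B₀ *ᵥ (L *ᵥ y)) := by
      rw [dotProduct_comm, dotProduct_transpose_mulVec]
    have a6 : s ⬝ᵥ ((Lw * kronCol (1 : Matrix (Fin m) (Fin m) ℝ) σ) *ᵥ s) =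
        s ⬝ᵥ (kronRow (1 : Matrix (Fin m) (Fin m) ℝ) σ *ᵥ (Lwᵀ *ᵥ s)) := by
      have : kronRow (1 : Matrix (Fin m) (Fin m) ℝ) σ =
          (kronCol (1 : Matrix (Fin m) (Fin m) ℝ) σ)ᵀ := by
        rw [kronCol_transpose, transpose_one]
      rw [mulVec_mulVec, this, ← transpose_mul, dotProduct_transpose_mulVec]
    rw [a1, a2, ← hv, hkr]
    simp only [sub_mulVec, neg_mulVec, dotProduct_sub, dotProduct_neg, a3, a4, a6, smul_mulVec,
      one_mulVec, dotProduct_smul, smul_eq_mul, add_dotProduct, a5]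
    rw [dotProduct_comm η v, hη]
    simp only [mulVec_add, dotProduct_add, ← mulVec_mulVec]
    ring
  constructor
  · have := h.posSemidef.dotProduct_mulVec_nonneg (Sum.elim (Sum.elim y s) (Sum.elim 0 v))
    rw [star_trivial, hform] at this
    linarith
  · intro hy
    by_contra hs0
    have hne : (Sum.elim (Sum.elim y s) (Sum.elim 0 v) :
        (ι ⊕ Fin m) ⊕ ((ι ⊕ Fin m) ⊕ (Fin m × ι)) → ℝ) ≠ 0 := fun h0 =>
      hs0 (funext fun i => congrFun h0 (Sum.inl (Sum.inr i)))
    have := h.dotProduct_mulVec_pos hne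
    rw [star_trivial, hform, hy] at this
    simp at this
    linarith

variable {Q : Matrix ι ι ℝ} {S z : ι → ℝ} {R c τ : ℝ}
    {A P : Matrix ι ι ℝ} {B₀ : Matrix ι (Fin m) ℝ} {Bt : Matrix ι (Fin m × ι) ℝ}
    {L : Matrix (Fin m) ι ℝ} {Lw : Matrix (Fin m) (Fin m × ι) ℝ} {Λ : Matrix (Fin m) (Fin m) ℝ}

/-- The gain matrix is invertible wherever the multiplier form is nonnegative at `(z, 1)`. -/
lemma gain_isUnit (hQ : (-Q).PosDef) (hR : 0 < R) (hP : Pᵀ = P) (hΛ : Λ.PosDef)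
    (h : (stabilityMatrix A B₀ Bt Q S R c τ P L Lw Λ).PosDef)
    (hz : 0 ≤ z ⬝ᵥ (Q *ᵥ z) + 2 * (S ⬝ᵥ z) + R) : IsUnit (1 - Lw * kronCol Λ⁻¹ z) := by
  rw [← isUnit_transpose, gain_transpose hΛ, ← mulVec_injective_iff_isUnit]
  refine (injective_iff_map_eq_zero (1 - kronRow Λ⁻¹ z * Lwᵀ).mulVecLin).2 fun s hs => ?_
  rw [mulVecLin_apply, sub_mulVec, one_mulVec, sub_eq_zero, ← mulVec_mulVec] at hs
  exact (stability_form hQ hR hP hΛ h hz 0 s (by simpa using hs)).2 rfl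

/-- Dissipation along the closed loop of the bilinear lifted system, with costate `P⁻¹ z`. -/
lemma closed_loop_dissipation (hQ : (-Q).PosDef) (hR : 0 < R) (hP : P.PosDef) (hΛ : Λ.PosDef)
    (h : (stabilityMatrix A B₀ Bt Q S R c τ P L Lw Λ).PosDef)
    (hz : 0 ≤ z ⬝ᵥ (Q *ᵥ z) + 2 * (S ⬝ᵥ z) + R) (u : Fin m → ℝ)
    (hu : u = ((1 - Lw * kronCol Λ⁻¹ z)⁻¹ * L * P⁻¹) *ᵥ z) :
    2 * ((P⁻¹ *ᵥ z) ⬝ᵥ (A *ᵥ z + B₀ *ᵥ u + Bt *ᵥ (kronCol 1 z *ᵥ u))) ≤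
      -τ * ((P⁻¹ *ᵥ z) ⬝ᵥ (P⁻¹ *ᵥ z)) := by
  have hPu : IsUnit P.det := (Matrix.isUnit_iff_isUnit_det _).1 hP.isUnit
  have hPs := transpose_eq_of_posDef hP
  have hG := gain_isUnit hQ hR hPs hΛ h hz
  have hGd := (Matrix.isUnit_iff_isUnit_det _).1 hG
  have hGt := gain_transpose (Lw := Lw) (z := z) hΛ
  set G := 1 - Lw * kronCol Λ⁻¹ z with hGdef
  set y := P⁻¹ *ᵥ z with hy
  have hPy : P *ᵥ y = z := by rw [hy, mulVec_mulVec, mul_nonsing_inv _ hPu, one_mulVec]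
  set p := (Gᵀ)⁻¹ *ᵥ (B₀ᵀ *ᵥ y + kronRow 1 z *ᵥ (Btᵀ *ᵥ y)) with hp
  have hGp : Gᵀ *ᵥ p = B₀ᵀ *ᵥ y + kronRow 1 z *ᵥ (Btᵀ *ᵥ y) := by
    rw [hp, mulVec_mulVec, mul_nonsing_inv _ (by rwa [det_transpose]), one_mulVec]
  have hGu : G *ᵥ u = L *ᵥ y := by
    rw [hu, mulVec_mulVec, Matrix.mul_assoc, ← Matrix.mul_assoc, mul_nonsing_inv _ hGd,
      Matrix.one_mul, ← mulVec_mulVec]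
  have hps : B₀ᵀ *ᵥ y + (p - B₀ᵀ *ᵥ y) = p := by abel
  have hmain := (stability_form hQ hR hPs hΛ h hz y (p - B₀ᵀ *ᵥ y) (by
    rw [hps, sub_eq_iff_eq_add]
    have h1 := hGp
    rw [hGt, sub_mulVec, one_mulVec, ← mulVec_mulVec, sub_eq_iff_eq_add] at h1
    nth_rewrite 1 [h1]; abel)).1
  rw [hps, hPy, ← hGu, ← dotProduct_transpose_mulVec G, hGp, dotProduct_add] at hmain
  have e1 : u ⬝ᵥ (B₀ᵀ *ᵥ y) = y ⬝ᵥ (B₀ *ᵥ u) := dotProduct_transpose_mulVec _ _ _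
  have e2 : u ⬝ᵥ (kronRow (1 : Matrix (Fin m) (Fin m) ℝ) z *ᵥ (Btᵀ *ᵥ y)) =
      y ⬝ᵥ (Bt *ᵥ (kronCol (1 : Matrix (Fin m) (Fin m) ℝ) z *ᵥ u)) := by
    have : kronRow (1 : Matrix (Fin m) (Fin m) ℝ) z =
        (kronCol (1 : Matrix (Fin m) (Fin m) ℝ) z)ᵀ := by
      rw [kronCol_transpose, transpose_one]
    rw [this, mulVec_mulVec, ← transpose_mul, dotProduct_transpose_mulVec, mulVec_mulVec]
  rw [e1, e2] at hmain
  simp only [dotProduct_add]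
  linarith

end Dissipation

/-! ### The generator on the dictionary -/

section Generator

variable {n q m : ℕ} {f : State n → State n} {g : Fin m → State n → State n}
  {ψ : Fin q → State n → ℝ} {X : Set (State n)} {U : Set (Fin m → ℝ)}

/-- The derivative `DΦ̂(x) v` of the reduced lifting, component by component. -/
noncomputable def liftDeriv (ψ : Fin q → State n → ℝ) (x v : State n) : LiftIdx n q → ℝ :=
  fun k => fderiv ℝ (fun y => liftHat ψ y k) x v

lemma contDiff_liftHat {r : WithTop ℕ∞} (hψ : ∀ k, ContDiff ℝ r (ψ k)) (k : LiftIdx n q) :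
    ContDiff ℝ r (fun y => liftHat ψ y k) := by
  rcases k with i | k
  · exact (EuclideanSpace.proj i : State n →L[ℝ] ℝ).contDiff
  · exact hψ k

lemma continuous_lift (hψ : ∀ k, ContDiff ℝ 2 (ψ k)) (k : Unit ⊕ LiftIdx n q) :
    Continuous fun y => lift ψ y k := by
  rcases k with _ | k
  · exact continuous_const
  · exact (contDiff_liftHat hψ k).continuous

lemma liftHat_zero (hψ0 : ∀ k, ψ k 0 = 0) : liftHat ψ 0 = 0 := by
  ext (i | k)
  · rfl
  · exact hψ0 k

lemma liftDeriv_controlField (x : State n) (u : Fin m → ℝ) :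
    liftDeriv ψ x (controlField f g u x) =
      liftDeriv ψ x (f x) + ∑ i, u i • liftDeriv ψ x (g i x) := by
  ext k
  simp [liftDeriv, controlField]

/-- The generator leaves the dictionary invariant: on `X`, the derivative of an observable along the
flow of a constant control is a pointwise limit of difference quotients, which belong to the
dictionary, and a finite-dimensional space of functions on `X` is closed under pointwise limits. -/
lemma exists_coeff_liftDeriv (hψ : ∀ k, ContDiff ℝ 2 (ψ k)) (hsol : HasUniqueSolutions f g X U)
    (hinv : DictionaryInvariant f g ψ X U) {u : Fin m → ℝ} (hu : u ∈ U) (k : LiftIdx n q) :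
    ∃ c : Unit ⊕ LiftIdx n q → ℝ, ∀ x ∈ X,
      liftDeriv ψ x (controlField f g u x) k = c ⬝ᵥ lift ψ x := by
  have hex : ∀ x₀ ∈ X, ∃ x : ℝ → State n, x 0 = x₀ ∧
      IsSolutionOn (controlField f g u) (Ici 0) x := fun x₀ hx₀ => by
    obtain ⟨x, h0, h1, -⟩ := hsol u hu x₀ hx₀
    exact ⟨x, h0, h1⟩
  choose! sol hsol0 hsolI using hex
  set W : Submodule ℝ (X → ℝ) :=
    (dictionary ψ).map (LinearMap.funLeft ℝ ℝ (Subtype.val : X → State n)) with hW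
  have : FiniteDimensional ℝ (dictionary ψ) := FiniteDimensional.span_of_finite ℝ (finite_range _)
  have hWc : IsClosed (W : Set (X → ℝ)) := W.closed_of_finiteDimensional
  set φ : State n → ℝ := fun y => liftHat ψ y k with hφ
  have hφm : φ ∈ dictionary ψ := Submodule.subset_span ⟨Sum.inr k, rfl⟩
  set t : ℕ → ℝ := fun j => 1 / ((j : ℝ) + 1)
  have ht : ∀ j, 0 < t j := fun j => Nat.one_div_pos_of_nat
  have hmem : (fun x : X => liftDeriv ψ x (controlField f g u x) k) ∈ (W : Set (X → ℝ)) := by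
    refine hWc.mem_of_tendsto (b := atTop)
      (f := fun (j : ℕ) (x : X) => (t j)⁻¹ * (φ (sol x (t j)) - φ x)) ?_ (Eventually.of_forall ?_)
    · rw [tendsto_pi_nhds]
      intro x
      have h1 : HasDerivWithinAt (fun s => φ (sol x s))
          (fderiv ℝ φ (x : State n) (controlField f g u x)) (Ici 0) 0 := by
        have h2 := hsolI x x.2 0 self_mem_Ici
        have h3 : HasFDerivAt φ (fderiv ℝ φ (sol x 0)) (sol x 0) :=
          ((contDiff_liftHat hψ k).differentiable (by norm_num) _).hasFDerivAt
        have h4 := h3.comp_hasDerivWithinAt (0 : ℝ) h2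
        rwa [hsol0 x x.2] at h4
      rw [hasDerivWithinAt_iff_tendsto_slope] at h1
      have h5 : Tendsto t atTop (𝓝[Ici 0 \ {0}] 0) :=
        tendsto_nhdsWithin_iff.2 ⟨tendsto_one_div_add_atTop_nhds_zero_nat,
          Eventually.of_forall fun j => ⟨(ht j).le, (ht j).ne'⟩⟩
      refine (h1.comp h5).congr fun j => ?_
      simp [slope, hsol0 x x.2]
    · intro j
      obtain ⟨φ', hφ', h⟩ := hinv u hu (t j) (ht j).le φ hφm
      refine ⟨(t j)⁻¹ • (φ' - φ), Submodule.smul_mem _ _ (Submodule.sub_mem _ hφ' hφm), ?_⟩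
      ext x
      have := h (sol x) (by rw [hsol0 x x.2]; exact x.2) (hsolI x x.2)
      rw [hsol0 x x.2] at this
      simp [LinearMap.funLeft, this]
  obtain ⟨φ', hφ', h⟩ := hmem
  obtain ⟨c, hc⟩ := (Submodule.mem_span_range_iff_exists_fun ℝ).1 hφ'
  refine ⟨c, fun x hx => ?_⟩
  rw [← congrFun h ⟨x, hx⟩, ← hc]
  simp [LinearMap.funLeft, dotProduct]

/-- On `X` the lifted dynamics are affine in the input, with coefficients in the dictionary. The
input directions are reached because `U` is a neighbourhood of zero. -/
lemma exists_lifted_model (hψ : ∀ k, ContDiff ℝ 2 (ψ k)) (hU0 : (0 : Fin m → ℝ) ∈ interior U)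
    (hsol : HasUniqueSolutions f g X U) (hinv : DictionaryInvariant f g ψ X U) :
    ∃ (C₀ : Matrix (LiftIdx n q) (Unit ⊕ LiftIdx n q) ℝ)
      (C : Fin m → Matrix (LiftIdx n q) (Unit ⊕ LiftIdx n q) ℝ),
      (∀ x ∈ X, liftDeriv ψ x (f x) = C₀ *ᵥ lift ψ x) ∧
      ∀ i, ∀ x ∈ X, liftDeriv ψ x (g i x) = C i *ᵥ lift ψ x := by
  have key : ∀ u ∈ U, ∃ C : Matrix (LiftIdx n q) (Unit ⊕ LiftIdx n q) ℝ, ∀ x ∈ X,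
      liftDeriv ψ x (controlField f g u x) = C *ᵥ lift ψ x := fun u hu => by
    choose c hc using exists_coeff_liftDeriv hψ hsol hinv hu
    exact ⟨of c, fun x hx => funext fun k => hc k x hx⟩
  obtain ⟨C₀, hC₀⟩ := key 0 (interior_subset hU0)
  have hdrift : ∀ x ∈ X, liftDeriv ψ x (f x) = C₀ *ᵥ lift ψ x := fun x hx => by
    simpa [controlField] using hC₀ x hx
  have hin : ∀ i : Fin m, ∃ C : Matrix (LiftIdx n q) (Unit ⊕ LiftIdx n q) ℝ, ∀ x ∈ X,
      liftDeriv ψ x (g i x) = C *ᵥ lift ψ x := fun i => by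
    have hcont : Tendsto (fun ε : ℝ => ε • (Pi.single i 1 : Fin m → ℝ)) (𝓝[>] 0) (𝓝 0) := by
      refine ((continuous_id.smul continuous_const).tendsto' 0 0 (by simp)).mono_left
        nhdsWithin_le_nhds
    obtain ⟨ε, hεU, hε⟩ :=
      ((hcont.eventually (mem_interior_iff_mem_nhds.1 hU0)).and self_mem_nhdsWithin).exists
    have hε : 0 < ε := hε
    obtain ⟨C, hC⟩ := key _ hεU
    refine ⟨ε⁻¹ • (C - C₀), fun x hx => ?_⟩
    have h1 := hC x hx
    rw [liftDeriv_controlField, hdrift x hx, Finset.sum_eq_single i (by simp +contextual) (by simp)]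
      at h1
    rw [smul_mulVec, sub_mulVec, ← h1]
    simp [smul_smul, hε.ne']
  choose C hC using hin
  exact ⟨C₀, C, hdrift, hC⟩

end Generator

/-! ### Exactness of the least-squares estimates -/

section EDMD

variable {n q m : ℕ} {f : State n → State n} {g : Fin m → State n → State n}
  {ψ : Fin q → State n → ℝ} {X : Set (State n)} {U : Set (Fin m → ℝ)}

lemma frobenius_zero {a b : Type} [Fintype a] [Fintype b] :
    frobenius (0 : Matrix a b ℝ) = 0 := by simp [frobenius]

lemma eq_zero_of_frobenius_le_zero {a b : Type} [Fintype a] [Fintype b] {M : Matrix a b ℝ}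
    (h : frobenius M ≤ 0) : M = 0 := by
  have h1 : ∑ i, ∑ j, M i j ^ 2 ≤ 0 := Real.sqrt_eq_zero'.1 (le_antisymm h (Real.sqrt_nonneg _))
  ext i j
  have h2 := (Finset.sum_eq_zero_iff_of_nonneg
    (fun i _ => Finset.sum_nonneg fun j _ => sq_nonneg (M i j))).1
    (le_antisymm h1 (Finset.sum_nonneg fun i _ => Finset.sum_nonneg fun j _ => sq_nonneg _)) i
    (Finset.mem_univ i)
  have h3 := (Finset.sum_eq_zero_iff_of_nonneg (fun j _ => sq_nonneg (M i j))).1 h2 j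
    (Finset.mem_univ j)
  exact pow_eq_zero_iff (two_ne_zero) |>.1 h3

/-- The lifted samples span: no nontrivial linear combination of the observables vanishes at all
sampling points. -/
def DataExciting (ψ : Fin q → State n → ℝ) {d : ℕ} (x : Fin d → State n) : Prop :=
  ∀ a : Unit ⊕ LiftIdx n q → ℝ, (∀ j, a ⬝ᵥ lift ψ (x j) = 0) → a = 0

lemma DataExciting.matrix_eq {d : ℕ} {x : Fin d → State n} (hx : DataExciting ψ x)
    {C C' : Matrix (LiftIdx n q) (Unit ⊕ LiftIdx n q) ℝ}
    (h : ∀ j, C *ᵥ lift ψ (x j) = C' *ᵥ lift ψ (x j)) : C = C' := by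
  ext k l
  have := hx (C k - C' k) fun j => by
    rw [sub_dotProduct, sub_eq_zero]; exact congrFun (h j) k
  exact sub_eq_zero.1 (congrFun this l)

/-- The full lifting is `(1, Φ̂)`, so a matrix acts on it through its first column and the rest. -/
lemma fromCols_mulVec_lift (b : LiftIdx n q → ℝ) (M : Matrix (LiftIdx n q) (LiftIdx n q) ℝ)
    (x : State n) :
    fromCols (replicateCol Unit b) M *ᵥ lift ψ x = b + M *ᵥ liftHat ψ x := by
  rw [lift, fromCols_mulVec]
  ext k
  simp [mulVec, dotProduct]

/-- With exciting data, the least-squares estimates recover the lifted dynamics exactly. The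
equilibrium at the origin removes the constant term from the drift. -/
lemma lifted_dynamics_of_isEDMD (hψ : ∀ k, ContDiff ℝ 2 (ψ k)) (hψ0 : ∀ k, ψ k 0 = 0)
    (hf0 : f 0 = 0) (hX0 : (0 : State n) ∈ X) (hU0 : (0 : Fin m → ℝ) ∈ interior U)
    (hsol : HasUniqueSolutions f g X U) (hinv : DictionaryInvariant f g ψ X U)
    {d : Option (Fin m) → ℕ} {x : ∀ k, Fin (d k) → State n} (hxX : ∀ k j, x k j ∈ X)
    (hx : ∀ k, DataExciting ψ (x k))
    {A : Matrix (LiftIdx n q) (LiftIdx n q) ℝ} {B₀ : Matrix (LiftIdx n q) (Fin m) ℝ}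
    {Bhat : Fin m → Matrix (LiftIdx n q) (LiftIdx n q) ℝ} (h : IsEDMD f g ψ x A B₀ Bhat)
    {y : State n} (hy : y ∈ X) (u : Fin m → ℝ) :
    liftDeriv ψ y (controlField f g u y) = A *ᵥ liftHat ψ y + B₀ *ᵥ u +
      bilinearMatrix A Bhat *ᵥ (kronCol (1 : Matrix (Fin m) (Fin m) ℝ) (liftHat ψ y) *ᵥ u) := by
  obtain ⟨C₀, C, hC₀, hC⟩ := exists_lifted_model hψ hU0 hsol hinv
  have hcol : ∀ k, C₀ k (Sum.inl ()) = 0 := fun k => by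
    have h1 := congrFun (hC₀ 0 hX0) k
    rw [hf0, lift, liftHat_zero hψ0] at h1
    simpa [liftDeriv, mulVec, dotProduct] using h1.symm
  have hC₀' : C₀ = fromCols (replicateCol Unit 0) C₀.toCols₂ := by
    ext k (l | l)
    · simpa using hcol k
    · rfl
  have hcf : ∀ y, controlField f g (dataInput none) y = f y := fun y => by
    simp [dataInput, controlField]
  have hA : fromCols (replicateCol Unit (0 : LiftIdx n q → ℝ)) A = C₀ := by
    have h1 := h.drift C₀.toCols₂
    have h2 : dataY ψ (x none) (fun j => controlField f g (dataInput none) (x none j)) -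
        C₀.toCols₂ * dataXHat ψ (x none) = 0 := by
      ext k j
      have h3 := congrFun (hC₀ _ (hxX none j)) k
      rw [hC₀', fromCols_mulVec_lift, zero_add] at h3
      rw [Matrix.sub_apply, Matrix.zero_apply, sub_eq_zero]
      simp only [hcf]
      exact h3
    rw [h2, frobenius_zero] at h1
    have h4 := eq_zero_of_frobenius_le_zero h1
    refine (hx none).matrix_eq fun j => ?_
    rw [fromCols_mulVec_lift, zero_add, ← hC₀ _ (hxX none j)]
    ext k
    have h5 := congrFun (congrFun h4 k) j
    rw [Matrix.sub_apply, Matrix.zero_apply, sub_eq_zero] at h5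
    simp only [hcf] at h5
    exact h5.symm
  have hB : ∀ i, fromCols (replicateCol Unit (fun a => B₀ a i)) (Bhat i) = C₀ + C i := fun i => by
    have hgen : ∀ y ∈ X, liftDeriv ψ y (controlField f g (dataInput (some i)) y) =
        (C₀ + C i) *ᵥ lift ψ y := fun y hy => by
      rw [liftDeriv_controlField, dataInput, Finset.sum_eq_single i (by simp +contextual) (by simp),
        hC₀ y hy, hC i y hy, add_mulVec]
      simp
    have h1 := h.input i (C₀ + C i)
    have h2 : dataY ψ (x (some i)) (fun j => controlField f g (dataInput (some i)) (x (some i) j)) -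
        (C₀ + C i) * dataX ψ (x (some i)) = 0 := by
      ext k j
      rw [Matrix.sub_apply, Matrix.zero_apply, sub_eq_zero]
      exact congrFun (hgen _ (hxX (some i) j)) k
    rw [h2, frobenius_zero] at h1
    have h4 := eq_zero_of_frobenius_le_zero h1
    refine (hx (some i)).matrix_eq fun j => ?_
    rw [← hgen _ (hxX (some i) j)]
    ext k
    have h5 := congrFun (congrFun h4 k) j
    rw [Matrix.sub_apply, Matrix.zero_apply, sub_eq_zero] at h5
    exact h5.symm
  rw [liftDeriv_controlField, hC₀ y hy, ← hA, fromCols_mulVec_lift, zero_add, add_assoc]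
  congr 1
  ext k
  have h6 : ∀ i, liftDeriv ψ y (g i y) k =
      B₀ k i + (Bhat i *ᵥ liftHat ψ y) k - (A *ᵥ liftHat ψ y) k := fun i => by
    have h7 : C i = fromCols (replicateCol Unit (fun a => B₀ a i)) (Bhat i) -
      fromCols (replicateCol Unit (0 : LiftIdx n q → ℝ)) A := by rw [hB, hA]; simp
    rw [hC i y hy, h7, sub_mulVec, fromCols_mulVec_lift, fromCols_mulVec_lift]
    simp
  simp only [Finset.sum_apply, Pi.smul_apply, smul_eq_mul, h6, Pi.add_apply]
  simp only [mulVec, dotProduct, bilinearMatrix, kronCol, of_apply, Fintype.sum_prod_type,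
    ← Finset.sum_add_distrib]
  refine Finset.sum_congr rfl fun i _ => ?_
  simp only [one_apply, ite_mul, one_mul, zero_mul, Finset.sum_ite_eq, Finset.mem_univ, if_true,
    Matrix.sub_apply, sub_mul, Finset.sum_sub_distrib, mul_sub, mul_add, Finset.mul_sum]
  simp only [mul_left_comm (u i), mul_comm (u i)]
  ring

end EDMD

/-! ### Spanning samples with high probability -/

section Sampling

/-- Independent samples miss a given set with probability equal to a power. -/
lemma measure_forall_notMem {E : Type} [MeasurableSpace E] {ρ : Measure E}
    {Ω : Type u} [MeasurableSpace Ω] {Pr : Measure Ω} {d : ℕ} {ξ : Fin d → Ω → E}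
    (hξ : ∀ j, Measurable (ξ j)) (hlaw : ∀ j, Pr.map (ξ j) = ρ)
    (hind : iIndepFun ξ Pr) {V : Set E} (hV : MeasurableSet V) :
    Pr (⋂ j, ξ j ⁻¹' Vᶜ) = ρ Vᶜ ^ d := by
  rw [hind.meas_iInter fun j => ⟨Vᶜ, hV.compl, rfl⟩]
  simp only [← Measure.map_apply (hξ _) hV.compl, hlaw, Finset.prod_const, Finset.card_univ,
    Fintype.card_fin]

variable {E K : Type} [TopologicalSpace E] [MeasurableSpace E]
  [HereditarilyLindelofSpace E] [Fintype K] {ρ : Measure E} {F : E → K → ℝ}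

/-- Points of the support of `ρ` whose feature vectors form a basis can be perturbed: there are
finitely many open sets of positive measure such that feature vectors at points chosen one from each
of them span. -/
lemma exists_open_sets_of_linearIndependent_ae (hF : Continuous F)
    (hρ : ∀ a : K → ℝ, (∀ᵐ x ∂ρ, a ⬝ᵥ F x = 0) → a = 0) :
    ∃ (N : ℕ) (V : Fin N → Set E), (∀ i, IsOpen (V i)) ∧ (∀ i, 0 < ρ (V i)) ∧
      ∀ y : Fin N → E, (∀ i, y i ∈ V i) →
        ∀ a : K → ℝ, (∀ i, a ⬝ᵥ F (y i) = 0) → a = 0 := by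
  set S : Set (K → ℝ) := F '' ρ.support
  -- a functional vanishing on the feature vectors of the support vanishes almost everywhere
  have hspan : Submodule.span ℝ S = ⊤ := by
    by_contra hne
    obtain ⟨φ, hφ0, hφ⟩ := Submodule.exists_le_ker_of_lt_top _ (lt_top_iff_ne_top.2 hne)
    classical
    set b : K → ℝ := fun k => φ fun j => if k = j then 1 else 0
    have hrep : ∀ v : K → ℝ, φ v = b ⬝ᵥ v := fun v => by
      rw [LinearMap.pi_apply_eq_sum_univ φ v, dotProduct_comm]
      rfl
    refine hφ0 (LinearMap.ext fun v => ?_)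
    have h0 : b = 0 := by
      refine hρ _ ?_
      filter_upwards [Measure.support_mem_ae (μ := ρ)] with x hx
      rw [← hrep]
      exact hφ (Submodule.subset_span ⟨x, hx, rfl⟩)
    rw [hrep, h0, zero_dotProduct, LinearMap.zero_apply]
  obtain ⟨N, hN, p, hpS, hp⟩ : ∃ N, N = Module.finrank ℝ (K → ℝ) ∧
      ∃ p : Fin N → K → ℝ, (∀ i, p i ∈ S) ∧ LinearIndependent ℝ p := by
    obtain ⟨p, hpS, -, hp⟩ := Submodule.exists_fun_fin_finrank_span_eq ℝ S
    exact ⟨_, by rw [hspan, finrank_top], p, hpS, hp⟩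
  choose y₀ hy₀ hy₀p using hpS
  have hopen : IsOpen {y : Fin N → E | LinearIndependent ℝ fun i => F (y i)} :=
    isOpen_setOfPred_linearIndependent.preimage
      (continuous_pi fun i => hF.comp (continuous_apply i))
  have hmem : {y : Fin N → E | LinearIndependent ℝ fun i => F (y i)} ∈ 𝓝 y₀ :=
    hopen.mem_nhds (by
      have : (fun i => F (y₀ i)) = p := funext hy₀p
      simpa only [mem_ofPred_eq, this] using hp)
  obtain ⟨V, hV, hVsub⟩ := (isOpen_pi_iff'.1 hopen) y₀ (mem_of_mem_nhds hmem)
  refine ⟨N, V, fun i => (hV i).1, fun i => ?_, fun y hy a ha => ?_⟩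
  · have h1 := hy₀ i
    rw [Measure.support_eq_forall_isOpen] at h1
    exact h1 _ (hV i).2 (hV i).1
  · have hli : LinearIndependent ℝ fun i => F (y i) := hVsub fun i _ => hy i
    have htop := hli.span_eq_top_of_card_eq_finrank' (by rw [Fintype.card_fin, hN])
    have hle : Submodule.span ℝ (range fun i => F (y i)) ≤
        LinearMap.ker (dotProductBilin ℝ ℝ a) := by
      rw [Submodule.span_le]
      rintro _ ⟨i, rfl⟩
      exact ha i
    rw [htop] at hle
    have h2 : a ⬝ᵥ a = 0 := hle (Submodule.mem_top (x := a))
    exact dotProduct_self_eq_zero.1 h2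

/-- With high probability, sufficiently many independent samples hit all of the sets furnished by
`exists_open_sets_of_linearIndependent_ae`, and lie in a given closed set of full measure. -/
lemma exists_event_spanning_samples [OpensMeasurableSpace E] [IsProbabilityMeasure ρ]
    (hF : Continuous F)
    (hρ : ∀ a : K → ℝ, (∀ᵐ x ∂ρ, a ⬝ᵥ F x = 0) → a = 0) {X : Set E} (hX : IsClosed X)
    (hρX : ρ Xᶜ = 0) {κ : Type} [Fintype κ] {δ : ℝ} (hδ : 0 < δ) :
    ∃ d₀ : ℕ, ∀ d : κ → ℕ, (∀ k, d₀ ≤ d k) →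
      ∀ (Ω : Type u) [MeasurableSpace Ω] (Pr : Measure Ω) [IsProbabilityMeasure Pr]
        (ξ : ∀ k, Fin (d k) → Ω → E),
        (∀ k j, Measurable (ξ k j)) → (∀ k j, Pr.map (ξ k j) = ρ) → (∀ k, iIndepFun (ξ k) Pr) →
      ∃ G : Set Ω, MeasurableSet G ∧ ENNReal.ofReal (1 - δ) ≤ Pr G ∧ ∀ ω ∈ G,
        (∀ k j, ξ k j ω ∈ X) ∧
        ∀ k, ∀ a : K → ℝ, (∀ j, a ⬝ᵥ F (ξ k j ω) = 0) → a = 0 := by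
  obtain ⟨N, V, hVo, hVρ, hV⟩ := exists_open_sets_of_linearIndependent_ae hF hρ
  have hlt : ∀ i, ρ (V i)ᶜ < 1 := fun i => by
    rw [prob_compl_eq_one_sub (hVo i).measurableSet]
    exact ENNReal.sub_lt_self ENNReal.one_ne_top one_ne_zero (hVρ i).ne'
  have hlim : Tendsto (fun d : ℕ => ∑ _k : κ, ∑ i, ρ (V i)ᶜ ^ d) atTop (𝓝 0) := by
    have := tendsto_finsetSum (Finset.univ : Finset κ) fun _ _ =>
      tendsto_finsetSum (Finset.univ : Finset (Fin N)) fun i _ =>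
        ENNReal.tendsto_pow_atTop_nhds_zero_of_lt_one (hlt i)
    simpa using this
  obtain ⟨d₀, hd₀⟩ := eventually_atTop.1
    (hlim.eventually (eventually_le_nhds (ENNReal.ofReal_pos.2 hδ)))
  refine ⟨d₀, fun d hd Ω _ Pr _ ξ hξ hlaw hind => ?_⟩
  set B : Set Ω := (⋃ k, ⋃ j, ξ k j ⁻¹' Xᶜ) ∪ ⋃ k, ⋃ i, ⋂ j, ξ k j ⁻¹' (V i)ᶜ with hB
  have hBm : MeasurableSet B := by
    refine (MeasurableSet.iUnion fun k => MeasurableSet.iUnion fun j =>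
      hξ k j hX.measurableSet.compl).union (MeasurableSet.iUnion fun k =>
        MeasurableSet.iUnion fun i => MeasurableSet.iInter fun j =>
          hξ k j (hVo i).measurableSet.compl)
  have hnull : Pr (⋃ k, ⋃ j, ξ k j ⁻¹' Xᶜ) = 0 := by
    simp only [measure_iUnion_null_iff]
    intro k j
    rw [← Measure.map_apply (hξ k j) hX.measurableSet.compl, hlaw, hρX]
  have hBle : Pr B ≤ ENNReal.ofReal δ := by
    calc Pr B ≤ 0 + Pr (⋃ k, ⋃ i, ⋂ j, ξ k j ⁻¹' (V i)ᶜ) := hnull ▸ measure_union_le _ _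
      _ = Pr (⋃ k, ⋃ i, ⋂ j, ξ k j ⁻¹' (V i)ᶜ) := zero_add _
      _ ≤ ∑ k, ∑ i, Pr (⋂ j, ξ k j ⁻¹' (V i)ᶜ) :=
        (measure_iUnion_fintype_le _ _).trans
          (Finset.sum_le_sum fun k _ => measure_iUnion_fintype_le _ _)
      _ ≤ ∑ _k : κ, ∑ i, ρ (V i)ᶜ ^ d₀ := by
        refine Finset.sum_le_sum fun k _ => Finset.sum_le_sum fun i _ => ?_
        rw [measure_forall_notMem (hξ k) (hlaw k) (hind k) (hVo i).measurableSet]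
        exact pow_le_pow_right_of_le_one' prob_le_one (hd k)
      _ ≤ ENNReal.ofReal δ := hd₀ d₀ le_rfl
  refine ⟨Bᶜ, hBm.compl, ?_, fun ω hω => ⟨fun k j => ?_, fun k a ha => ?_⟩⟩
  · rw [prob_compl_eq_one_sub hBm, ENNReal.ofReal_sub _ hδ.le, ENNReal.ofReal_one]
    exact tsub_le_tsub_left hBle 1
  · by_contra h
    exact hω (Or.inl (mem_iUnion₂.2 ⟨k, j, h⟩))
  · have h1 : ∀ i, ∃ j, ξ k j ω ∈ V i := fun i => by
      by_contra! h
      exact hω (Or.inr (mem_iUnion₂.2 ⟨k, i, mem_iInter.2 h⟩))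
    choose j hj using h1
    exact hV (fun i => ξ k (j i) ω) hj a fun i => ha (j i)

end Sampling

/-! ### Global solutions and Lyapunov functions -/

section Flow

variable {E : Type} [NormedAddCommGroup E] [NormedSpace ℝ E]

/-- A bounded globally Lipschitz vector field has a solution on `[0, ∞)`: by boundedness the
Picard-Lindelöf theorem applies on `[0, T]` for every `T`, and these solutions agree. -/
lemma exists_solution_Ici [CompleteSpace E] {F : E → E} {K L : NNReal} (hF : LipschitzWith K F)
    (hL : ∀ x, ‖F x‖ ≤ L) (x₀ : E) :
    ∃ x : ℝ → E, x 0 = x₀ ∧ ∀ t ∈ Ici (0 : ℝ), HasDerivWithinAt x (F (x t)) (Ici 0) t := by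
  have hex : ∀ N : ℕ, ∃ y : ℝ → E, y 0 = x₀ ∧
      ∀ t ∈ Icc (0 : ℝ) (N + 1), HasDerivWithinAt y (F (y t)) (Icc 0 (N + 1)) t := fun N => by
    have hN : (0 : ℝ) ≤ N + 1 := by positivity
    have hP : IsPicardLindelof (fun _ => F) (tmin := 0) (tmax := N + 1) ⟨0, le_rfl, hN⟩ x₀
        (L * (N + 1)) 0 L K :=
      IsPicardLindelof.of_time_independent (fun x _ => hL x) hF.lipschitzOnWith (by simp [hN])
    exact hP.exists_eq_forall_mem_Icc_hasDerivWithinAt₀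
  choose y hy0 hy using hex
  have huniq : ∀ M N : ℕ, M ≤ N → EqOn (y M) (y N) (Icc 0 (M + 1)) := fun M N hMN => by
    have hle : (M : ℝ) + 1 ≤ N + 1 := by exact_mod_cast Nat.succ_le_succ hMN
    have hcast : ∀ k : ℕ, ∀ b ≤ (k : ℝ) + 1, ∀ t ∈ Ico 0 b,
        HasDerivWithinAt (y k) (F (y k t)) (Ici t) t := fun k b hb t ht =>
      (hy k t ⟨ht.1, ht.2.le.trans hb⟩).mono_of_mem_nhdsWithin
        (mem_of_superset (Icc_mem_nhdsGE (ht.2.trans_le hb)) (Icc_subset_Icc_left ht.1))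
    have hcont : ∀ k : ℕ, ∀ b ≤ (k : ℝ) + 1, ContinuousOn (y k) (Icc 0 b) := fun k b hb t ht =>
      ((hy k t ⟨ht.1, ht.2.trans hb⟩).continuousWithinAt).mono (Icc_subset_Icc_right hb)
    exact ODE_solution_unique (v := fun _ => F) (fun _ => hF) (hcont M _ le_rfl)
      (hcast M _ le_rfl) (hcont N _ hle) (hcast N _ hle) (by rw [hy0, hy0])
  refine ⟨fun t => y ⌈t⌉₊ t, by simp [hy0], fun t ht => ?_⟩
  have ht : 0 ≤ t := ht
  set N := ⌈t⌉₊ + 1 with hN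
  have hagree : ∀ s ∈ Icc (0 : ℝ) N, y ⌈s⌉₊ s = y N s := fun s hs =>
    huniq _ _ (Nat.ceil_le.2 hs.2) ⟨hs.1, (Nat.le_ceil s).trans (by linarith)⟩
  have htN : t < N := by
    rw [hN]; push_cast; linarith [Nat.le_ceil t]
  have h1 := hy N t ⟨ht, by linarith⟩
  have h2 : HasDerivWithinAt (y N) (F (y N t)) (Ici 0) t := by
    refine h1.mono_of_mem_nhdsWithin ?_
    refine mem_nhdsWithin.2 ⟨Iio ((N : ℝ) + 1), isOpen_Iio, ?_, fun s hs => ⟨hs.2, hs.1.le⟩⟩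
    simp only [mem_Iio]; linarith
  beta_reduce
  rw [hagree t ⟨ht, htN.le⟩]
  refine h2.congr_of_eventuallyEq ?_ (hagree t ⟨ht, htN.le⟩)
  filter_upwards [mem_nhdsWithin_of_mem_nhds (Iio_mem_nhds htN), self_mem_nhdsWithin] with s hs hs0
  exact hagree s ⟨hs0, hs.le⟩

/-- A vector field that is `C¹` near a compact set agrees there with a compactly supported `C¹`
field. -/
lemma exists_contDiff_hasCompactSupport_eqOn [FiniteDimensional ℝ E] {F : E → E} {R O : Set E}
    (hR : IsCompact R) (hO : IsOpen O) (hRO : R ⊆ O) (hF : ∀ x ∈ O, ContDiffAt ℝ 1 F x) :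
    ∃ G : E → E, ContDiff ℝ 1 G ∧ HasCompactSupport G ∧ EqOn G F R := by
  obtain ⟨T, hT, hRT, hTO⟩ := exists_compact_between hR hO hRO
  obtain ⟨χ, hχ1, hχ0, -⟩ := exists_contMDiffMap_one_nhds_of_subset_interior (n := 1)
    (modelWithCornersSelf ℝ E) hR.isClosed hRT
  have hχ : ContDiff ℝ 1 χ := χ.contMDiff.contDiff
  refine ⟨fun x => χ x • F x, contDiff_iff_contDiffAt.2 fun x => ?_,
    HasCompactSupport.intro hT fun x hx => by simp [hχ0 x hx], fun x hx => ?_⟩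
  · by_cases hx : x ∈ T
    · exact hχ.contDiffAt.smul (hF x (hTO hx))
    · refine (contDiffAt_const (c := (0 : E))).congr_of_eventuallyEq ?_
      filter_upwards [hT.isClosed.isOpen_compl.mem_nhds hx] with z hz
      simp [hχ0 z hz]
  · simp [hχ1.self_of_nhdsSet x hx]

/-- A sublevel set of a Lyapunov function with exponential decrease on it is invariant, and the
function decays exponentially along solutions. The vector field is arbitrary off the sublevel
set. -/
lemma lyapunov_decay {V : E → ℝ} (hV : Differentiable ℝ V) {F : E → E} {a : ℝ} (ha : 0 < a)
    (hdec : ∀ x, V x ≤ 1 → fderiv ℝ V x (F x) ≤ -a * V x) {x : ℝ → E} {T : ℝ} (h0 : V (x 0) ≤ 1)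
    (hx : ∀ t ∈ Ico 0 T, HasDerivWithinAt x (F (x t)) (Ico 0 T) t) {t : ℝ} (ht : t ∈ Ico 0 T) :
    V (x t) ≤ 1 ∧ V (x t) ≤ V (x 0) * Real.exp (-a * t) := by
  have hd : ∀ s ∈ Ico 0 T,
      HasDerivWithinAt (fun s => V (x s)) (fderiv ℝ V (x s) (F (x s))) (Ico 0 T) s := fun s hs =>
    (hV (x s)).hasFDerivAt.comp_hasDerivWithinAt s (hx s hs)
  have hsub : Icc 0 t ⊆ Ico 0 T := fun s hs => ⟨hs.1, hs.2.trans_lt ht.2⟩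
  have hcont : ContinuousOn (fun s => V (x s)) (Icc 0 t) := fun s hs =>
    (hd s (hsub hs)).continuousWithinAt.mono hsub
  have hr : ∀ s ∈ Ico 0 t,
      HasDerivWithinAt (fun s => V (x s)) (fderiv ℝ V (x s) (F (x s))) (Ici s) s := fun s hs =>
    (hd s (hsub ⟨hs.1, hs.2.le⟩)).mono_of_mem_nhdsWithin
      (mem_of_superset (Ico_mem_nhdsGE (hs.2.trans ht.2)) (Ico_subset_Ico_left hs.1))
  have hle : ∀ s ∈ Icc 0 t, V (x s) ≤ 1 := by
    refine image_le_of_deriv_right_lt_deriv_boundary (B := fun _ => 1) (B' := fun _ => 0) hcont hr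
      h0 (fun s => hasDerivAt_const s 1) fun s hs h1 => ?_
    have := hdec (x s) h1.le
    rw [show V (x s) = 1 from h1] at this
    linarith
  refine ⟨hle t ⟨ht.1, le_rfl⟩, ?_⟩
  have := le_gronwallBound_of_liminf_deriv_right_le (K := -a) (ε := 0) (δ := V (x 0)) hcont
    (fun s hs r hr' => (hr s hs).liminf_right_slope_le hr') le_rfl
    (fun s hs => by simpa using hdec (x s) (hle s ⟨hs.1, hs.2.le⟩)) t ⟨ht.1, le_rfl⟩
  simpa [gronwallBound_ε0] using this

end Flow

/-! ### Smoothness of matrix-valued maps -/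

section Smoothness

variable {E : Type} [NormedAddCommGroup E] [NormedSpace ℝ E] {r : WithTop ℕ∞} {x : E}
  {a b : Type} [Fintype a]

lemma contDiffAt_mulVec {M : E → Matrix b a ℝ} {v : E → a → ℝ}
    (hM : ∀ i j, ContDiffAt ℝ r (fun y => M y i j) x) (hv : ∀ j, ContDiffAt ℝ r (fun y => v y j) x)
    (i : b) : ContDiffAt ℝ r (fun y => (M y *ᵥ v y) i) x := by
  simp only [mulVec, dotProduct]
  exact ContDiffAt.sum fun j _ => (hM i j).mul (hv j)

lemma contDiffAt_matrix_mul {c : Type} {M : E → Matrix b a ℝ} {N : E → Matrix a c ℝ}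
    (hM : ∀ i j, ContDiffAt ℝ r (fun y => M y i j) x)
    (hN : ∀ i j, ContDiffAt ℝ r (fun y => N y i j) x) (i : b) (j : c) :
    ContDiffAt ℝ r (fun y => (M y * N y) i j) x := by
  simp only [mul_apply]
  exact ContDiffAt.sum fun k _ => (hM i k).mul (hN k j)

variable [DecidableEq a]

lemma contDiffAt_det {M : E → Matrix a a ℝ} (hM : ∀ i j, ContDiffAt ℝ r (fun y => M y i j) x) :
    ContDiffAt ℝ r (fun y => (M y).det) x := by
  simp only [det_apply']
  exact ContDiffAt.sum fun σ _ => contDiffAt_const.mul (contDiffAt_prod fun i _ => hM _ _)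

lemma contDiffAt_matrix_inv {M : E → Matrix a a ℝ}
    (hM : ∀ i j, ContDiffAt ℝ r (fun y => M y i j) x) (hdet : (M x).det ≠ 0) (i j : a) :
    ContDiffAt ℝ r (fun y => (M y)⁻¹ i j) x := by
  simp only [inv_def, Ring.inverse_eq_inv', Matrix.smul_apply, smul_eq_mul, adjugate_apply]
  refine ((contDiffAt_det hM).inv hdet).mul (contDiffAt_det fun k l => ?_)
  by_cases hk : k = j
  · subst hk; simpa only [updateRow_self] using contDiffAt_const
  · simpa only [updateRow_ne hk] using hM k l

end Smoothness

/-! ### Bounds on quadratic forms -/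

section QuadraticForms

variable {ι : Type} [Fintype ι]

lemma exists_quadratic_bound (M : Matrix ι ι ℝ) :
    ∃ C > 0, ∀ v : ι → ℝ, v ⬝ᵥ (M *ᵥ v) ≤ C * (v ⬝ᵥ v) := by
  refine ⟨(∑ i, ∑ j, |M i j|) + 1, by positivity, fun v => ?_⟩
  have hsq : ∀ i, v i ^ 2 ≤ v ⬝ᵥ v := fun i => by
    rw [sq]
    exact Finset.single_le_sum (f := fun i => v i * v i) (fun j _ => mul_self_nonneg _)
      (Finset.mem_univ i)
  have h1 : v ⬝ᵥ (M *ᵥ v) ≤ ∑ i, ∑ j, |M i j| * (v ⬝ᵥ v) := by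
    simp only [dotProduct, mulVec, Finset.mul_sum]
    refine Finset.sum_le_sum fun i _ => Finset.sum_le_sum fun j _ => ?_
    have h2 : |v i * v j| ≤ v ⬝ᵥ v := by
      rw [abs_mul]
      nlinarith [sq_nonneg (|v i| - |v j|), sq_abs (v i), sq_abs (v j), hsq i, hsq j]
    calc v i * (M i j * v j) = M i j * (v i * v j) := by ring
      _ ≤ |M i j * (v i * v j)| := le_abs_self _
      _ = |M i j| * |v i * v j| := abs_mul _ _
      _ ≤ _ := by rw [← Finset.mul_sum]; exact mul_le_mul_of_nonneg_left h2 (abs_nonneg _)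
  simp only [← Finset.sum_mul] at h1
  have : 0 ≤ v ⬝ᵥ v := Finset.sum_nonneg fun i _ => mul_self_nonneg (v i)
  linarith

lemma exists_le_quadratic_inv [DecidableEq ι] {P : Matrix ι ι ℝ} (hP : P.PosDef) :
    ∃ C > 0, ∀ v : ι → ℝ, v ⬝ᵥ v ≤ C * (v ⬝ᵥ (P⁻¹ *ᵥ v)) := by
  have hPu : IsUnit P.det := (Matrix.isUnit_iff_isUnit_det _).1 hP.isUnit
  obtain ⟨C, hC, hb⟩ := exists_quadratic_bound P
  refine ⟨C, hC, fun v => ?_⟩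
  -- expand the form of `P` at `P⁻¹ v - C⁻¹ v`
  have h1 := hP.posSemidef.dotProduct_mulVec_nonneg (P⁻¹ *ᵥ v - C⁻¹ • v)
  have hPv : P *ᵥ (P⁻¹ *ᵥ v) = v := by rw [mulVec_mulVec, mul_nonsing_inv _ hPu, one_mulVec]
  have hsymm := dotProduct_mulVec_comm_of_isSymm (transpose_eq_of_posDef hP) (P⁻¹ *ᵥ v) v
  rw [hPv] at hsymm
  simp only [star_trivial, mulVec_sub, mulVec_smul, hPv, sub_dotProduct, dotProduct_sub,
    smul_dotProduct, dotProduct_smul, smul_eq_mul, hsymm] at h1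
  have h2 : C⁻¹ * (C⁻¹ * (v ⬝ᵥ (P *ᵥ v))) ≤ C⁻¹ * (v ⬝ᵥ v) := by
    have := mul_le_mul_of_nonneg_left (hb v) (mul_nonneg (inv_nonneg.2 hC.le) (inv_nonneg.2 hC.le))
    calc _ = C⁻¹ * C⁻¹ * (v ⬝ᵥ (P *ᵥ v)) := by ring
      _ ≤ _ := this
      _ = _ := by field_simp
  rw [dotProduct_comm (P⁻¹ *ᵥ v) v] at h1
  have h3 : C⁻¹ * (v ⬝ᵥ v) ≤ v ⬝ᵥ (P⁻¹ *ᵥ v) := by linarith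
  rwa [inv_mul_le_iff₀ hC] at h3

end QuadraticForms

/-! ### The closed loop -/

section ClosedLoop

variable {n q m : ℕ} {ψ : Fin q → State n → ℝ}

/-- The quadratic Lyapunov function `Φ̂(x)ᵀ P⁻¹ Φ̂(x)`. -/
noncomputable def lyapunov (ψ : Fin q → State n → ℝ) (P : Matrix (LiftIdx n q) (LiftIdx n q) ℝ)
    (x : State n) : ℝ :=
  liftHat ψ x ⬝ᵥ (P⁻¹ *ᵥ liftHat ψ x)

lemma mem_regionOfAttraction {P : Matrix (LiftIdx n q) (LiftIdx n q) ℝ} {x : State n} :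
    x ∈ regionOfAttraction ψ P ↔ lyapunov ψ P x ≤ 1 := Iff.rfl

lemma zero_mem_regionOfAttraction (hψ0 : ∀ k, ψ k 0 = 0)
    (P : Matrix (LiftIdx n q) (LiftIdx n q) ℝ) : (0 : State n) ∈ regionOfAttraction ψ P := by
  rw [mem_regionOfAttraction, lyapunov, liftHat_zero hψ0, zero_dotProduct]
  exact zero_le_one

/-- The right-hand side of the bilinear lifted system. -/
def liftedField (A : Matrix (LiftIdx n q) (LiftIdx n q) ℝ) (B₀ : Matrix (LiftIdx n q) (Fin m) ℝ)
    (Bt : Matrix (LiftIdx n q) (Fin m × LiftIdx n q) ℝ) (z : LiftIdx n q → ℝ) (u : Fin m → ℝ) :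
    LiftIdx n q → ℝ :=
  A *ᵥ z + B₀ *ᵥ u + Bt *ᵥ (kronCol (1 : Matrix (Fin m) (Fin m) ℝ) z *ᵥ u)

lemma hasFDerivAt_lyapunov (hψ : ∀ k, ContDiff ℝ 2 (ψ k)) (P : Matrix (LiftIdx n q) (LiftIdx n q) ℝ)
    (x : State n) :
    HasFDerivAt (lyapunov ψ P) (∑ k, ∑ l, (P⁻¹ k l) • (liftHat ψ x k •
      fderiv ℝ (fun y => liftHat ψ y l) x +
        liftHat ψ x l • fderiv ℝ (fun y => liftHat ψ y k) x)) x := by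
  have h1 : ∀ k, HasFDerivAt (fun y => liftHat ψ y k) (fderiv ℝ (fun y => liftHat ψ y k) x) x :=
    fun k => ((contDiff_liftHat hψ k).differentiable (by norm_num) x).hasFDerivAt
  have h2 : lyapunov ψ P = fun y => ∑ k, ∑ l, P⁻¹ k l * (liftHat ψ y k * liftHat ψ y l) := by
    ext y
    simp only [lyapunov, dotProduct, mulVec, Finset.mul_sum]
    exact Finset.sum_congr rfl fun k _ => Finset.sum_congr rfl fun l _ => by ring
  rw [h2]
  exact HasFDerivAt.fun_sum fun k _ => HasFDerivAt.fun_sum fun l _ =>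
    ((h1 k).mul (h1 l)).const_mul _

lemma fderiv_lyapunov (hψ : ∀ k, ContDiff ℝ 2 (ψ k)) {P : Matrix (LiftIdx n q) (LiftIdx n q) ℝ}
    (hP : P.PosDef) (x v : State n) :
    fderiv ℝ (lyapunov ψ P) x v = 2 * ((P⁻¹ *ᵥ liftHat ψ x) ⬝ᵥ liftDeriv ψ x v) := by
  have h1 : fderiv ℝ (lyapunov ψ P) x v = liftHat ψ x ⬝ᵥ (P⁻¹ *ᵥ liftDeriv ψ x v) +
      liftDeriv ψ x v ⬝ᵥ (P⁻¹ *ᵥ liftHat ψ x) := by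
    rw [(hasFDerivAt_lyapunov hψ P x).fderiv]
    simp only [_root_.sum_apply, _root_.smul_apply,
      _root_.add_apply, smul_eq_mul, dotProduct, mulVec, Finset.mul_sum,
      ← Finset.sum_add_distrib, liftDeriv]
    exact Finset.sum_congr rfl fun k _ => Finset.sum_congr rfl fun l _ => by ring
  rw [h1, dotProduct_mulVec_comm_of_isSymm (transpose_eq_of_posDef hP.inv), dotProduct_comm]
  ring

lemma sq_norm_le_liftHat (ψ : Fin q → State n → ℝ) (x : State n) :
    ‖x‖ ^ 2 ≤ liftHat ψ x ⬝ᵥ liftHat ψ x := by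
  rw [EuclideanSpace.norm_sq_eq, dotProduct, Fintype.sum_sum_type]
  have h1 : 0 ≤ ∑ k : Fin q, liftHat ψ x (Sum.inr k) * liftHat ψ x (Sum.inr k) :=
    Finset.sum_nonneg fun k _ => mul_self_nonneg _
  have h2 : ∑ i, ‖x i‖ ^ 2 = ∑ i : Fin n, liftHat ψ x (Sum.inl i) * liftHat ψ x (Sum.inl i) :=
    Finset.sum_congr rfl fun i _ => by rw [Real.norm_eq_abs, sq_abs, sq]; rfl
  linarith

/-- On a compact convex set containing the origin, the lifting is bounded by a multiple of the
state. -/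
lemma exists_liftHat_le (hψ : ∀ k, ContDiff ℝ 2 (ψ k)) (hψ0 : ∀ k, ψ k 0 = 0) {X : Set (State n)}
    (hX : IsCompact X) (hXc : Convex ℝ X) (hX0 : (0 : State n) ∈ X) :
    ∃ C ≥ 0, ∀ x ∈ X, liftHat ψ x ⬝ᵥ liftHat ψ x ≤ C * ‖x‖ ^ 2 := by
  have h1 : ∀ k : LiftIdx n q, ∃ C : ℝ, ∀ x ∈ X, |liftHat ψ x k| ≤ C * ‖x‖ := fun k => by
    have hk := contDiff_liftHat hψ k
    obtain ⟨C, hC⟩ := hX.exists_bound_of_continuousOn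
      (hk.continuous_fderiv (by norm_num)).continuousOn
    refine ⟨C, fun x hx => ?_⟩
    have := hXc.norm_image_sub_le_of_norm_fderiv_le
      (fun y _ => hk.differentiable (by norm_num) y) hC hX0 hx
    simpa [liftHat_zero hψ0] using this
  choose C hC using h1
  refine ⟨∑ k, C k ^ 2, Finset.sum_nonneg fun k _ => sq_nonneg _, fun x hx => ?_⟩
  rw [dotProduct, Finset.sum_mul]
  refine Finset.sum_le_sum fun k _ => ?_
  have := pow_le_pow_left₀ (abs_nonneg _) (hC k x hx) 2
  rw [sq_abs, mul_pow] at this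
  rwa [← sq]

variable {A P Q : Matrix (LiftIdx n q) (LiftIdx n q) ℝ} {B₀ : Matrix (LiftIdx n q) (Fin m) ℝ}
  {Bt : Matrix (LiftIdx n q) (Fin m × LiftIdx n q) ℝ} {S : LiftIdx n q → ℝ} {R c τ ν : ℝ}
  {L : Matrix (Fin m) (LiftIdx n q) ℝ} {Lw : Matrix (Fin m) (Fin m × LiftIdx n q) ℝ}
  {Λ : Matrix (Fin m) (Fin m) ℝ}

/-- The closed loop of the bilinear lifted system, read off at the state coordinates, is smooth
where the gain matrix is invertible. -/
lemma contDiffAt_closedLoop (hψ : ∀ k, ContDiff ℝ 2 (ψ k)) {x : State n}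
    (hx : IsUnit (gainMatrix ψ Lw Λ x)) :
    ContDiffAt ℝ 1 (fun y => (WithLp.toLp 2 fun i =>
      liftedField A B₀ Bt (liftHat ψ y) (controller ψ P L Lw Λ y) (Sum.inl i) : State n)) x := by
  have hdet : (gainMatrix ψ Lw Λ x).det ≠ 0 := ((Matrix.isUnit_iff_isUnit_det _).1 hx).ne_zero
  have hz : ∀ k, ContDiffAt ℝ 1 (fun y => liftHat ψ y k) x := fun k =>
    ((contDiff_liftHat hψ k).of_le (by norm_num)).contDiffAt
  have hcol : ∀ (M : Matrix (Fin m) (Fin m) ℝ) i j,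
      ContDiffAt ℝ 1 (fun y => kronCol M (liftHat ψ y) i j) x := fun M i j =>
    contDiffAt_const.mul (hz _)
  have hgain : ∀ i j, ContDiffAt ℝ 1 (fun y => gainMatrix ψ Lw Λ y i j) x := fun i j =>
    contDiffAt_const.sub
      (contDiffAt_matrix_mul (M := fun _ => Lw) (fun _ _ => contDiffAt_const) (hcol _) i j)
  have hu : ∀ i, ContDiffAt ℝ 1 (fun y => controller ψ P L Lw Λ y i) x :=
    contDiffAt_mulVec (contDiffAt_matrix_mul
      (contDiffAt_matrix_mul (contDiffAt_matrix_inv hgain hdet) fun _ _ => contDiffAt_const)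
      fun _ _ => contDiffAt_const) hz
  refine contDiffAt_piLp' _ fun i => ?_
  exact ((contDiffAt_mulVec (M := fun _ => A) (fun _ _ => contDiffAt_const) hz _).add
    (contDiffAt_mulVec (M := fun _ => B₀) (fun _ _ => contDiffAt_const) hu _)).add
    (contDiffAt_mulVec (M := fun _ => Bt) (fun _ _ => contDiffAt_const)
      (contDiffAt_mulVec (hcol _) hu) _)

/-- If the lifted system is exactly bilinear on a set containing the region of attraction, then
feasibility of the linear matrix inequalities certifies the controller. -/
theorem closedLoop_exponentiallyStableOn {f : State n → State n} {g : Fin m → State n → State n}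
    {X : Set (State n)} (hψ : ∀ k, ContDiff ℝ 2 (ψ k)) (hψ0 : ∀ k, ψ k 0 = 0)
    (hX : IsCompact X) (hXconv : Convex ℝ X)
    (hmodel : ∀ y ∈ X, ∀ u, liftDeriv ψ y (controlField f g u y) =
      liftedField A B₀ Bt (liftHat ψ y) u)
    (hQ : (-Q).PosDef) (hR : 0 < R) (hP : P.PosDef) (hΛ : Λ.PosDef) (hν : 0 < ν) (hτ : 0 < τ)
    (hstab : (stabilityMatrix A B₀ Bt Q S R c τ P L Lw Λ).PosDef)
    (hinvar : (invarianceMatrix Q S R ν P).PosSemidef) (hRoA : regionOfAttraction ψ P ⊆ X) :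
    (∀ x ∈ regionOfAttraction ψ P, IsUnit (gainMatrix ψ Lw Λ x)) ∧
    ExponentiallyStableOn (fun x => controlField f g (controller ψ P L Lw Λ x) x)
      (regionOfAttraction ψ P) := by
  have hPu : IsUnit P.det := (Matrix.isUnit_iff_isUnit_det _).1 hP.isUnit
  have hmult : ∀ x ∈ regionOfAttraction ψ P,
      0 ≤ liftHat ψ x ⬝ᵥ (Q *ᵥ liftHat ψ x) + 2 * (S ⬝ᵥ liftHat ψ x) + R := fun x hx =>
    multiplier_form_nonneg_of_invarianceMatrix hQ hP hν hinvar hx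
  have hgain : ∀ x ∈ regionOfAttraction ψ P, IsUnit (gainMatrix ψ Lw Λ x) := fun x hx =>
    gain_isUnit hQ hR (transpose_eq_of_posDef hP) hΛ hstab (hmult x hx)
  have hX0 : (0 : State n) ∈ X := hRoA (zero_mem_regionOfAttraction hψ0 P)
  have hV : Differentiable ℝ (lyapunov ψ P) := fun x =>
    (hasFDerivAt_lyapunov hψ P x).differentiableAt
  obtain ⟨C₁, hC₁, hb₁⟩ := exists_quadratic_bound P
  obtain ⟨C₂, hC₂, hb₂⟩ := exists_le_quadratic_inv hP
  obtain ⟨C₃, hC₃, hb₃⟩ := exists_quadratic_bound P⁻¹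
  obtain ⟨C₄, hC₄, hb₄⟩ := exists_liftHat_le hψ hψ0 hX hXconv hX0
  set F : State n → State n := fun x => controlField f g (controller ψ P L Lw Λ x) x with hF
  have ha : 0 < τ / C₁ := div_pos hτ hC₁
  -- the term `-τ I` in the first block gives the decay rate
  have hdec : ∀ x, lyapunov ψ P x ≤ 1 →
      fderiv ℝ (lyapunov ψ P) x (F x) ≤ -(τ / C₁) * lyapunov ψ P x := fun x hx => by
    rw [fderiv_lyapunov hψ hP, hmodel x (hRoA hx)]
    refine (closed_loop_dissipation hQ hR hP hΛ hstab (hmult x hx) _ rfl).trans ?_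
    have h1 := hb₁ (P⁻¹ *ᵥ liftHat ψ x)
    rw [mulVec_mulVec, mul_nonsing_inv _ hPu, one_mulVec, dotProduct_comm] at h1
    have h2 := mul_le_mul_of_nonneg_left h1 ha.le
    have h3 : τ / C₁ * (C₁ * ((P⁻¹ *ᵥ liftHat ψ x) ⬝ᵥ (P⁻¹ *ᵥ liftHat ψ x))) =
        τ * ((P⁻¹ *ᵥ liftHat ψ x) ⬝ᵥ (P⁻¹ *ᵥ liftHat ψ x)) := by field_simp
    rw [lyapunov]
    linarith
  refine ⟨hgain, fun x₀ hx₀ => ?_, Real.sqrt (C₂ * C₃ * C₄) + 1, by positivity, τ / C₁ / 2,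
    half_pos ha, fun x T hx0 hx t ht => ?_⟩
  · -- extend the closed loop smoothly off the region of attraction, where it need not be regular
    set Fs : State n → State n := fun y => (WithLp.toLp 2 fun i =>
      liftedField A B₀ Bt (liftHat ψ y) (controller ψ P L Lw Λ y) (Sum.inl i) : State n) with hFs
    have hFFs : EqOn Fs F (regionOfAttraction ψ P) := fun y hy => by
      ext i
      have h1 := congrFun (hmodel y (hRoA hy) (controller ψ P L Lw Λ y)) (Sum.inl i)
      have h2 : ∀ v, liftDeriv ψ y v (Sum.inl i) = v i := fun v => by
        change fderiv ℝ (EuclideanSpace.proj i : State n →L[ℝ] ℝ) y v = v i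
        rw [ContinuousLinearMap.fderiv]
        rfl
      rw [h2] at h1
      exact h1.symm
    have hdetc : Continuous fun y => (gainMatrix ψ Lw Λ y).det := by
      refine Continuous.matrix_det (continuous_matrix fun i j => ?_)
      simp only [gainMatrix, Matrix.sub_apply, mul_apply, kronCol, of_apply]
      have := fun k => (contDiff_liftHat hψ k).continuous
      fun_prop
    have hcomp : IsCompact (regionOfAttraction ψ P) :=
      hX.of_isClosed_subset (isClosed_le hV.continuous continuous_const) hRoA
    obtain ⟨G, hG, hGc, hGF⟩ := exists_contDiff_hasCompactSupport_eqOn hcomp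
      (hdetc.isOpen_preimage _ isOpen_ne)
      (fun y hy => ((Matrix.isUnit_iff_isUnit_det _).1 (hgain y hy)).ne_zero)
      (F := Fs) fun y hy => contDiffAt_closedLoop hψ
        ((Matrix.isUnit_iff_isUnit_det _).2 (isUnit_iff_ne_zero.2 hy))
    have hGF' : EqOn G F (regionOfAttraction ψ P) := hGF.trans hFFs
    obtain ⟨K, hK⟩ := hG.lipschitzWith_of_hasCompactSupport hGc one_ne_zero
    obtain ⟨B, hB⟩ := hGc.exists_bound_of_continuous hG.continuous
    obtain ⟨x, hx0, hx⟩ := exists_solution_Ici (L := B.toNNReal) hK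
      (fun y => (hB y).trans (Real.le_coe_toNNReal B)) x₀
    refine ⟨x, hx0, fun t ht => ?_⟩
    have hmem := (lyapunov_decay hV ha (F := G) (T := t + 1)
      (fun y hy => by rw [hGF' hy]; exact hdec y hy) (by rw [hx0]; exact hx₀)
      (fun s hs => (hx s hs.1).mono Ico_subset_Ici_self) (t := t)
      ⟨ht, lt_add_one t⟩).1
    have h1 := hx t ht
    rwa [hGF' hmem] at h1
  · obtain ⟨h1, h2⟩ := lyapunov_decay hV ha hdec hx0 hx ht
    refine ⟨h1, ?_⟩
    have h3 : ‖x t‖ ^ 2 ≤ C₂ * C₃ * C₄ * (Real.exp (-(τ / C₁) * t) * ‖x 0‖ ^ 2) := by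
      calc ‖x t‖ ^ 2 ≤ C₂ * lyapunov ψ P (x t) := (sq_norm_le_liftHat ψ _).trans (hb₂ _)
        _ ≤ C₂ * ((C₃ * (C₄ * ‖x 0‖ ^ 2)) * Real.exp (-(τ / C₁) * t)) := by
          refine mul_le_mul_of_nonneg_left (h2.trans ?_) hC₂.le
          refine mul_le_mul_of_nonneg_right ?_ (Real.exp_pos _).le
          exact (hb₃ _).trans (mul_le_mul_of_nonneg_left (hb₄ _ (hRoA hx0)) hC₃.le)
        _ = _ := by ring
    have h4 : Real.exp (-(τ / C₁) * t) = Real.exp (-(τ / C₁ / 2) * t) ^ 2 := by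
      rw [← Real.exp_nat_mul]; congr 1; push_cast; ring
    have h5 : C₂ * C₃ * C₄ ≤ (Real.sqrt (C₂ * C₃ * C₄) + 1) ^ 2 := by
      have hs := Real.sq_sqrt (show 0 ≤ C₂ * C₃ * C₄ by positivity)
      nlinarith [Real.sqrt_nonneg (C₂ * C₃ * C₄)]
    refine le_of_sq_le_sq ?_ (by positivity)
    refine h3.trans ?_
    rw [h4, mul_pow, mul_pow, mul_assoc (_ ^ 2)]
    exact mul_le_mul_of_nonneg_right h5 (by positivity)

end ClosedLoop

end KoopmanControl

theorem theorem2 {n q m : ℕ}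
    -- the system, the observables, the state and control constraint sets
    (f : KoopmanControl.State n → KoopmanControl.State n)
    (g : Fin m → KoopmanControl.State n → KoopmanControl.State n)
    (ψ : Fin q → KoopmanControl.State n → ℝ)
    (X : Set (KoopmanControl.State n)) (U : Set (Fin m → ℝ))
    (hf0 : f 0 = 0)
    (hψ : ∀ k, ContDiff ℝ 2 (ψ k)) (hψ0 : ∀ k, ψ k 0 = 0)
    (hX : IsCompact X) (hXconv : Convex ℝ X)
    (hU : IsCompact U) (hU0 : (0 : Fin m → ℝ) ∈ interior U)
    (hsol : KoopmanControl.HasUniqueSolutions f g X U)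
    (hinv : KoopmanControl.DictionaryInvariant f g ψ X U)
    -- the sampling distribution on `X`, for which the observables are linearly independent
    (ρ : Measure (KoopmanControl.State n)) [IsProbabilityMeasure ρ] (hρX : ρ Xᶜ = 0)
    (hρ : ∀ a : Unit ⊕ KoopmanControl.LiftIdx n q → ℝ,
      (∀ᵐ x ∂ρ, ∑ k, a k * KoopmanControl.lift ψ x k = 0) → a = 0)
    (c δ : ℝ) (hc : 0 < c) (hδ : δ ∈ Ioo (0 : ℝ) 1) :
    ∃ d₀ : ℕ, ∀ d : Option (Fin m) → ℕ, (∀ k, d₀ ≤ d k) →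
      -- i.i.d. samples for each of the constant controls `0, e₁, …, e_m`
      ∀ (Ω : Type u) [MeasurableSpace Ω] (Pr : Measure Ω) [IsProbabilityMeasure Pr]
        (ξ : ∀ k, Fin (d k) → Ω → KoopmanControl.State n),
        (∀ k j, Measurable (ξ k j)) → (∀ k j, Pr.map (ξ k j) = ρ) →
        (∀ k, iIndepFun (ξ k) Pr) →
      -- the event of probability at least `1 - δ`
      ∃ G : Set Ω, MeasurableSet G ∧ ENNReal.ofReal (1 - δ) ≤ Pr G ∧ ∀ ω ∈ G,
        ∀ (A : Matrix (KoopmanControl.LiftIdx n q) (KoopmanControl.LiftIdx n q) ℝ)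
          (B₀ : Matrix (KoopmanControl.LiftIdx n q) (Fin m) ℝ)
          (Bhat : Fin m → Matrix (KoopmanControl.LiftIdx n q) (KoopmanControl.LiftIdx n q) ℝ),
          KoopmanControl.IsEDMD f g ψ (fun k j => ξ k j ω) A B₀ Bhat →
        ∀ (Q : Matrix (KoopmanControl.LiftIdx n q) (KoopmanControl.LiftIdx n q) ℝ)
          (S : KoopmanControl.LiftIdx n q → ℝ) (R : ℝ), (-Q).PosDef → 0 < R →
        ∀ (P : Matrix (KoopmanControl.LiftIdx n q) (KoopmanControl.LiftIdx n q) ℝ)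
          (L : Matrix (Fin m) (KoopmanControl.LiftIdx n q) ℝ)
          (Lw : Matrix (Fin m) (Fin m × KoopmanControl.LiftIdx n q) ℝ)
          (Λ : Matrix (Fin m) (Fin m) ℝ) (ν τ : ℝ),
          P.PosDef → Λ.PosDef → 0 < ν → 0 < τ →
          (KoopmanControl.stabilityMatrix A B₀ (KoopmanControl.bilinearMatrix A Bhat)
            Q S R c τ P L Lw Λ).PosDef →
          (KoopmanControl.invarianceMatrix Q S R ν P).PosSemidef →
          KoopmanControl.regionOfAttraction ψ P ⊆ X →
        -- the controller is well defined and exponentially stabilizes the system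
        (∀ x ∈ KoopmanControl.regionOfAttraction ψ P,
          IsUnit (KoopmanControl.gainMatrix ψ Lw Λ x)) ∧
        KoopmanControl.ExponentiallyStableOn
          (fun x => KoopmanControl.controlField f g (KoopmanControl.controller ψ P L Lw Λ x) x)
          (KoopmanControl.regionOfAttraction ψ P) := by
  obtain ⟨d₀, hd₀⟩ := KoopmanControl.exists_event_spanning_samples.{u} (κ := Option (Fin m))
    (F := KoopmanControl.lift ψ) (ρ := ρ)
    (continuous_pi fun k => KoopmanControl.continuous_lift hψ k) hρ hX.isClosed hρX hδ.1
  refine ⟨d₀, fun d hd Ω _ Pr _ ξ hξ hlaw hind => ?_⟩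
  obtain ⟨G, hGm, hGP, hG⟩ := hd₀ d hd Ω Pr ξ hξ hlaw hind
  refine ⟨G, hGm, hGP, fun ω hω A B₀ Bhat hEDMD Q S R hQ hR P L Lw Λ ν τ hP hΛ hν hτ hstab hinvar
    hRoA => ?_⟩
  have hX0 : (0 : KoopmanControl.State n) ∈ X :=
    hRoA (KoopmanControl.zero_mem_regionOfAttraction hψ0 P)
  exact KoopmanControl.closedLoop_exponentiallyStableOn hψ hψ0 hX hXconv
    (fun y hy u => KoopmanControl.lifted_dynamics_of_isEDMD hψ hψ0 hf0 hX0 hU0 hsol hinv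
      (hG ω hω).1 (hG ω hω).2 hEDMD hy u)
    hQ hR hP hΛ hν hτ hstab hinvar hRoA
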